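/- For a set $A$ of non-negative integers write $A(x)=\#(A\cap[1,x])$. The upper density of $A$ is $\limsup_{x\to\infty}A(x)/x$, and $A$ has density $d$ if $\lim_{x\to\infty}A(x)/x$ exists and equals $d$. Let $A+A$ and $A+A+A$ be the sets of sums of two, respectively three, not necessarily distinct elements of $A$, and let $\Sigma(A)$ be the set of all sums $\sum_{a\in S}a$ with $S$ a finite subset of $A$. (1) Let $A\subseteq\mathbb{N}$ have upper density $\delta$, and assume that $A+A$ contains no squarefree integer. If $\delta>\frac1{18}$, then $\Sigma(A+A)$ has upper density at most $\frac14$. If $\delta>\frac14-\frac2{\pi^2}$, then $\Sigma(A)$ has upper density at most $\frac12$. (2) There exists a set $A$ of positive integers of density $\frac1{18}$ such that $A+A$ contains no squarefree integer, $A+A+A$ contains a squarefree integer, and every sufficiently large even integer is a sum of at most $6$ (not necessarily distinct) elements of $A$. (3) For every $\epsilon>0$ there exist a set $A$ of positive integers and $\epsilon_1,\epsilon_2\in(0,\epsilon)$ such that $A+A$ contains no squarefree integer, $A$ has density $\frac14-\frac2{\pi^2}-\epsilon_1$, $A+A$ has density $1-\frac6{\pi^2}-\epsilon_2$, and $A+A+A$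 contains all positive integers with finitely many exceptions. -/

import Mathlib

open scoped Pointwise Topology

/-- The proportion of elements of `A` among the integers `1, …, n`. -/
noncomputable def densityUpTo (A : Set ℕ) (n : ℕ) : ℝ :=
  ((A ∩ Set.Icc 1 n).ncard : ℝ) / (n : ℝ)

/-- The upper asymptotic density of `A`. -/
noncomputable def upperDensity (A : Set ℕ) : ℝ :=
  Filter.limsup (densityUpTo A) Filter.atTop

/-- `A` has asymptotic density `d`: the limit exists and equals `d`. -/
def HasDensity (A : Set ℕ) (d : ℝ) : Prop :=
  Filter.Tendsto (densityUpTo A) Filter.atTop (𝓝 d)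

/-- The set of all sums of finite sets of (distinct) elements of `A`. -/
def subsetSums (A : Set ℕ) : Set ℕ :=
  {n | ∃ s : Finset ℕ, (s : Set ℕ) ⊆ A ∧ ∑ a ∈ s, a = n}

/-- `A` contains no squarefree integer. -/
def AvoidsSquarefree (A : Set ℕ) : Prop :=
  ∀ n ∈ A, ¬ Squarefree n

/-- `n` is a sum of at most `k` elements of `A`, repetitions allowed. -/
def IsSumOfAtMost (A : Set ℕ) (k n : ℕ) : Prop :=
  ∃ s : Multiset ℕ, Multiset.card s ≤ k ∧ (∀ a ∈ s, a ∈ A) ∧ s.sum = n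

section Density

open Filter

lemma ncard_inter_Icc_le (A : Set ℕ) (n : ℕ) : (A ∩ Set.Icc 1 n).ncard ≤ n := by
  have h := Set.ncard_le_ncard (s := A ∩ Set.Icc 1 n) (t := Set.Icc 1 n)
    Set.inter_subset_right (Set.finite_Icc 1 n)
  have h2 : (Set.Icc 1 n).ncard = n := by
    rw [← Finset.coe_Icc, Set.ncard_coe_finset]; simp
  omega

lemma finite_inter_Icc (A : Set ℕ) (n : ℕ) : (A ∩ Set.Icc 1 n).Finite :=
  (Set.finite_Icc 1 n).subset Set.inter_subset_right

lemma densityUpTo_nonneg (A : Set ℕ) (n : ℕ) : 0 ≤ densityUpTo A n := by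
  unfold densityUpTo; positivity

lemma densityUpTo_le_one (A : Set ℕ) (n : ℕ) : densityUpTo A n ≤ 1 := by
  unfold densityUpTo
  apply div_le_one_of_le₀ _ (by positivity)
  exact_mod_cast ncard_inter_Icc_le A n

lemma densityUpTo_mono {A B : Set ℕ} (h : A ⊆ B) (n : ℕ) :
    densityUpTo A n ≤ densityUpTo B n := by
  unfold densityUpTo
  gcongr
  exact finite_inter_Icc B n

lemma densityUpTo_union_le (A B : Set ℕ) (n : ℕ) :
    densityUpTo (A ∪ B) n ≤ densityUpTo A n + densityUpTo B n := by
  unfold densityUpTo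
  rw [← add_div]
  gcongr
  rw [Set.union_inter_distrib_right]
  exact_mod_cast Set.ncard_union_le _ _

lemma densityUpTo_union {A B : Set ℕ} (h : Disjoint A B) (n : ℕ) :
    densityUpTo (A ∪ B) n = densityUpTo A n + densityUpTo B n := by
  unfold densityUpTo
  rw [← add_div, Set.union_inter_distrib_right, Set.ncard_union_eq _ (finite_inter_Icc A n)
    (finite_inter_Icc B n)]
  · push_cast; rfl
  · exact h.mono Set.inter_subset_left Set.inter_subset_left

lemma isBoundedUnder_densityUpTo (A : Set ℕ) :
    IsBoundedUnder (· ≤ ·) atTop (densityUpTo A) :=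
  isBoundedUnder_of ⟨1, densityUpTo_le_one A⟩

lemma isCoboundedUnder_densityUpTo (A : Set ℕ) :
    IsCoboundedUnder (· ≤ ·) atTop (densityUpTo A) :=
  IsBoundedUnder.isCoboundedUnder_le (isBoundedUnder_of ⟨0, densityUpTo_nonneg A⟩)

lemma upperDensity_le {A : Set ℕ} {c : ℝ}
    (h : ∀ ε > 0, ∀ᶠ n in atTop, densityUpTo A n ≤ c + ε) : upperDensity A ≤ c :=
  le_of_forall_pos_le_add fun ε hε =>
    limsup_le_of_le (isCoboundedUnder_densityUpTo A) (h ε hε)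

lemma eventually_densityUpTo_lt {A : Set ℕ} {c : ℝ} (h : upperDensity A < c) :
    ∀ᶠ n in atTop, densityUpTo A n < c :=
  eventually_lt_of_limsup_lt h (isBoundedUnder_densityUpTo A)

lemma upperDensity_nonneg (A : Set ℕ) : 0 ≤ upperDensity A := by
  by_contra! h
  obtain ⟨n, hn⟩ := (eventually_densityUpTo_lt h).exists
  exact absurd (densityUpTo_nonneg A n) (not_le.mpr hn)

lemma upperDensity_mono {A B : Set ℕ} (h : A ⊆ B) : upperDensity A ≤ upperDensity B :=
  upperDensity_le fun ε hε => by
    filter_upwards [eventually_densityUpTo_lt (A := B) (c := upperDensity B + ε) (by linarith)]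
      with n hn
    exact (densityUpTo_mono h n).trans hn.le

lemma upperDensity_union_le (A B : Set ℕ) :
    upperDensity (A ∪ B) ≤ upperDensity A + upperDensity B :=
  upperDensity_le fun ε hε => by
    filter_upwards [eventually_densityUpTo_lt (A := A) (c := upperDensity A + ε / 2) (by linarith),
      eventually_densityUpTo_lt (A := B) (c := upperDensity B + ε / 2) (by linarith)] with n h1 h2
    linarith [densityUpTo_union_le A B n]

lemma HasDensity.upperDensity_eq {A : Set ℕ} {d : ℝ} (h : HasDensity A d) : upperDensity A = d :=
  Tendsto.limsup_eq h

lemma upperDensity_empty : upperDensity ∅ = 0 := by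
  have h : densityUpTo ∅ = fun _ => 0 := by
    funext n; simp [densityUpTo]
  simp [upperDensity, h]

lemma HasDensity.sdiff {A B : Set ℕ} {c d : ℝ} (hA : HasDensity A c) (hB : HasDensity B d)
    (h : B ⊆ A) : HasDensity (A \ B) (c - d) := by
  refine (Tendsto.sub hA hB).congr fun n => ?_
  have := densityUpTo_union (A := B) (B := A \ B) Set.disjoint_sdiff_right n
  rw [Set.union_sdiff_cancel h] at this
  linarith

lemma HasDensity.union {A B : Set ℕ} {c d : ℝ} (hA : HasDensity A c) (hB : HasDensity B d)
    (h : Disjoint A B) : HasDensity (A ∪ B) (c + d) :=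
  (Tendsto.add hA hB).congr fun n => (densityUpTo_union h n).symm

lemma hasDensity_of_abs_sub_le {A : Set ℕ} {d C : ℝ}
    (h : ∀ n : ℕ, |((A ∩ Set.Icc 1 n).ncard : ℝ) - d * n| ≤ C) : HasDensity A d := by
  unfold HasDensity
  rw [tendsto_iff_norm_sub_tendsto_zero]
  refine squeeze_zero' (Eventually.of_forall fun _ => norm_nonneg _) ?_
    (tendsto_const_div_atTop_nhds_zero_nat C)
  filter_upwards [eventually_gt_atTop 0] with n hn
  have hn' : (0 : ℝ) < n := by exact_mod_cast hn
  have : densityUpTo A n - d = (((A ∩ Set.Icc 1 n).ncard : ℝ) - d * n) / n := by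
    unfold densityUpTo; field_simp
  rw [this, norm_div, Real.norm_eq_abs, Real.norm_eq_abs, abs_of_pos hn']
  gcongr
  exact h n

lemma hasDensity_of_finite {A : Set ℕ} (h : A.Finite) : HasDensity A 0 := by
  refine hasDensity_of_abs_sub_le (C := A.ncard) fun n => ?_
  rw [zero_mul, sub_zero, abs_of_nonneg (by positivity)]
  exact_mod_cast Set.ncard_le_ncard Set.inter_subset_left h

lemma HasDensity.of_eventually_iff {A B : Set ℕ} {d : ℝ} (hA : HasDensity A d) (N : ℕ)
    (h : ∀ n, N ≤ n → (n ∈ A ↔ n ∈ B)) : HasDensity B d := by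
  have h1 : (A \ B).Finite := (Set.finite_lt_nat N).subset fun n hn => by
    by_contra hN
    exact hn.2 ((h n (by simpa using hN)).1 hn.1)
  have h2 : (B \ A).Finite := (Set.finite_lt_nat N).subset fun n hn => by
    by_contra hN
    exact hn.2 ((h n (by simpa using hN)).2 hn.1)
  have h3 := hA.sdiff (hasDensity_of_finite h1) Set.sdiff_subset
  have h4 := h3.union (hasDensity_of_finite h2)
    (Set.disjoint_left.2 fun n hn hn' => hn'.2 hn.1)
  have h5 : A \ (A \ B) ∪ B \ A = B := by
    ext n; simp only [Set.mem_union, Set.mem_sdiff]; tauto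
  rw [h5] at h4
  simpa using h4

lemma ncard_inter_Icc_add (A : Set ℕ) [DecidablePred (· ∈ A)] (n : ℕ) :
    (A ∩ Set.Icc 1 n).ncard + (if 0 ∈ A then 1 else 0) = Nat.count (· ∈ A) (n + 1) := by
  rw [Nat.count_succ', Nat.count_eq_card_filter_range]
  congr 1
  have : A ∩ Set.Icc 1 n = (fun k => k + 1) '' {k | k < n ∧ k + 1 ∈ A} := by
    ext k
    simp only [Set.mem_inter_iff, Set.mem_Icc, Set.mem_image, Set.mem_ofPred_eq]
    constructor
    · rintro ⟨h1, h2, h3⟩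
      exact ⟨k - 1, ⟨by omega, by rwa [Nat.sub_add_cancel h2]⟩, by omega⟩
    · rintro ⟨j, ⟨h1, h2⟩, rfl⟩
      exact ⟨h2, by omega, by omega⟩
  rw [this, Set.ncard_image_of_injective _ (add_left_injective 1), ← Set.ncard_coe_finset]
  congr 1
  ext k; simp

lemma count_periodic {P : ℕ → Prop} [DecidablePred P] {m : ℕ} (hP : Function.Periodic P m)
    (q r : ℕ) : Nat.count P (m * q + r) = q * Nat.count P m + Nat.count P r := by
  induction q with
  | zero => simp
  | succ q ih =>
    have h1 : m * (q + 1) + r = m + (m * q + r) := by ring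
    rw [h1, Nat.count_add]
    have h2 : Nat.count (fun k => P (m + k)) (m * q + r) = Nat.count P (m * q + r) := by
      congr 1
      funext k
      rw [add_comm, hP k]
    simp only [h2, ih]
    ring

lemma hasDensity_of_periodic {P : ℕ → Prop} [DecidablePred P] {m : ℕ} (hm : 0 < m)
    (hP : Function.Periodic P m) : HasDensity {n | P n} (Nat.count P m / m) := by
  refine hasDensity_of_abs_sub_le (C := m + 2) fun n => ?_
  have h1 := ncard_inter_Icc_add {n | P n} n
  simp only [Set.mem_ofPred_eq] at h1
  have h2 := count_periodic hP ((n + 1) / m) ((n + 1) % m)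
  rw [Nat.div_add_mod] at h2
  have h3 : Nat.count P ((n + 1) % m) ≤ m := (Nat.count_le P).trans (Nat.mod_lt _ hm).le
  have h4 : Nat.count P m ≤ m := Nat.count_le P
  have h5 : (((n + 1) / m : ℕ) : ℝ) * m + ((n + 1) % m : ℕ) = n + 1 := by
    exact_mod_cast Nat.div_add_mod' (n + 1) m
  have h6 : (((n + 1) % m : ℕ) : ℝ) ≤ m := by exact_mod_cast (Nat.mod_lt _ hm).le
  have h6' : (0 : ℝ) ≤ ((n + 1) % m : ℕ) := by positivity
  have h7 : (0 : ℝ) < m := by exact_mod_cast hm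
  set c : ℝ := Nat.count P m / m with hc
  have hc0 : 0 ≤ c := by positivity
  have hc1 : c ≤ 1 := by
    rw [hc, div_le_one h7]; exact_mod_cast h4
  have hcm : (Nat.count P m : ℝ) = c * m := by rw [hc]; field_simp
  have h8 : (({n | P n} ∩ Set.Icc 1 n).ncard : ℝ) + (if P 0 then 1 else 0 : ℕ)
      = ((n + 1) / m : ℕ) * (c * m) + Nat.count P ((n + 1) % m) := by
    rw [← hcm]
    exact_mod_cast h1.trans h2
  have h9 : ((if P 0 then 1 else 0 : ℕ) : ℝ) ≤ 1 := by split_ifs <;> simp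
  have h9' : (0 : ℝ) ≤ (if P 0 then 1 else 0 : ℕ) := by positivity
  have h3' : (Nat.count P ((n + 1) % m) : ℝ) ≤ m := by exact_mod_cast h3
  have h3'' : (0 : ℝ) ≤ Nat.count P ((n + 1) % m) := by positivity
  have h10 : (((n + 1) / m : ℕ) : ℝ) * (c * m) = c * n + c - c * ((n + 1) % m : ℕ) := by
    linear_combination c * h5
  have h11 : c * ((n + 1) % m : ℕ) ≤ m := by nlinarith
  have h12 : 0 ≤ c * ((n + 1) % m : ℕ) := by positivity
  rw [abs_le]
  constructor <;> linarith

lemma count_and_of_coprime {P Q : ℕ → Prop} [DecidablePred P] [DecidablePred Q] {m k : ℕ}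
    (hm : 0 < m) (hk : 0 < k) (hmk : m.Coprime k) (hP : Function.Periodic P m)
    (hQ : Function.Periodic Q k) :
    Nat.count (fun n => P n ∧ Q n) (m * k) = Nat.count P m * Nat.count Q k := by
  simp only [Nat.count_eq_card_filter_range]
  rw [← Finset.card_product]
  refine Finset.card_nbij' (fun n => (n % m, n % k))
    (fun x => (Nat.chineseRemainder hmk x.1 x.2 : ℕ)) ?_ ?_ ?_ ?_
  · intro n hn
    simp only [Finset.coe_filter, Finset.mem_range, Set.mem_ofPred_eq, Finset.coe_product,
      Set.mem_prod] at hn ⊢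
    rw [hP.map_mod_nat, hQ.map_mod_nat]
    exact ⟨⟨Nat.mod_lt _ hm, hn.2.1⟩, Nat.mod_lt _ hk, hn.2.2⟩
  · rintro ⟨a, b⟩ hab
    simp only [Finset.coe_filter, Finset.mem_range, Set.mem_ofPred_eq, Finset.coe_product,
      Set.mem_prod] at hab ⊢
    have h := (Nat.chineseRemainder hmk a b).2
    refine ⟨Nat.chineseRemainder_lt_mul hmk a b hm.ne' hk.ne', ?_, ?_⟩
    · rw [← hP.map_mod_nat, h.1, hP.map_mod_nat]; exact hab.1.2
    · rw [← hQ.map_mod_nat, h.2, hQ.map_mod_nat]; exact hab.2.2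
  · intro n hn
    simp only [Finset.coe_filter, Finset.mem_range, Set.mem_ofPred_eq] at hn
    refine ((Nat.chineseRemainder_modEq_unique hmk (z := n) ?_ ?_).eq_of_lt_of_lt hn.1
      (Nat.chineseRemainder_lt_mul hmk _ _ hm.ne' hk.ne')).symm
    · exact (Nat.mod_modEq n m).symm
    · exact (Nat.mod_modEq n k).symm
  · rintro ⟨a, b⟩ hab
    simp only [Finset.coe_filter, Finset.mem_range, Set.mem_ofPred_eq, Finset.coe_product,
      Set.mem_prod] at hab ⊢
    have h := (Nat.chineseRemainder hmk a b).2
    ext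
    · exact Eq.trans (show _ % m = a % m from h.1) (Nat.mod_eq_of_lt hab.1.1)
    · exact Eq.trans (show _ % k = b % k from h.2) (Nat.mod_eq_of_lt hab.2.1)

lemma periodic_and_mul {P Q : ℕ → Prop} {m k : ℕ} (hP : Function.Periodic P m)
    (hQ : Function.Periodic Q k) : Function.Periodic (fun n => P n ∧ Q n) (m * k) := fun n => by
  have h1 : P (n + m * k) = P n := by simpa [mul_comm] using hP.nat_mul k n
  have h2 : Q (n + m * k) = Q n := by simpa using hQ.nat_mul m n
  simp only [h1, h2]

lemma hasDensity_sieve {M s : ℕ} (hM : 0 < M) {S : Finset ℕ} {Q : ℕ → ℕ → Prop}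
    [∀ p, DecidablePred (Q p)]
    (hS : ∀ p ∈ S, p.Prime) (hMS : ∀ p ∈ S, M.Coprime p)
    (hQ : ∀ p ∈ S, Function.Periodic (Q p) (p ^ 2)) :
    HasDensity {n | n ≡ s [MOD M] ∧ ∀ p ∈ S, Q p n}
      (1 / M * ∏ p ∈ S, (Nat.count (Q p) (p ^ 2) : ℝ) / (p : ℝ) ^ 2) := by
  have key : Function.Periodic (fun n => n ≡ s [MOD M] ∧ ∀ p ∈ S, Q p n) (M * ∏ p ∈ S, p ^ 2) ∧
      Nat.count (fun n => n ≡ s [MOD M] ∧ ∀ p ∈ S, Q p n) (M * ∏ p ∈ S, p ^ 2)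
        = ∏ p ∈ S, Nat.count (Q p) (p ^ 2) := by
    induction S using Finset.induction_on with
    | empty =>
      constructor
      · intro n; simp [Nat.ModEq]
      · simp only [Finset.notMem_empty, false_imp_iff, implies_true, and_true, Finset.prod_empty,
          mul_one]
        rw [Nat.count_modEq_card _ hM]
        simp [Nat.div_self hM]
    | insert p S hp ih =>
      have ih' := ih (fun q hq => hS q (Finset.mem_insert_of_mem hq))
        (fun q hq => hMS q (Finset.mem_insert_of_mem hq))
        (fun q hq => hQ q (Finset.mem_insert_of_mem hq))
      have hpp := hS p (Finset.mem_insert_self p S)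
      have e1 : (fun n => n ≡ s [MOD M] ∧ ∀ q ∈ insert p S, Q q n)
          = fun n => (n ≡ s [MOD M] ∧ ∀ q ∈ S, Q q n) ∧ Q p n := by
        funext n
        rw [Finset.forall_mem_insert]
        exact propext (by tauto)
      have e2 : M * ∏ q ∈ insert p S, q ^ 2 = (M * ∏ q ∈ S, q ^ 2) * p ^ 2 := by
        rw [Finset.prod_insert hp]; ring
      have hQp := hQ p (Finset.mem_insert_self p S)
      have hco : (M * ∏ q ∈ S, q ^ 2).Coprime (p ^ 2) := by
        apply Nat.Coprime.pow_right
        apply Nat.Coprime.mul_left (hMS p (Finset.mem_insert_self p S))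
        apply Nat.Coprime.prod_left
        intro q hq
        apply Nat.Coprime.pow_left
        rw [Nat.coprime_primes (hS q (Finset.mem_insert_of_mem hq)) hpp]
        rintro rfl
        exact hp hq
      have hpos : 0 < M * ∏ q ∈ S, q ^ 2 := Nat.mul_pos hM (Finset.prod_pos fun q hq =>
        pow_pos (hS q (Finset.mem_insert_of_mem hq)).pos 2)
      refine ⟨?_, ?_⟩
      · rw [e1, e2]
        exact periodic_and_mul ih'.1 hQp
      · rw [e2, Finset.prod_insert hp, mul_comm (Nat.count (Q p) (p ^ 2)), ← ih'.2,
          ← count_and_of_coprime hpos (pow_pos hpp.pos 2) hco ih'.1 hQp]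
        simp only [e1]
  have hpos : 0 < M * ∏ p ∈ S, p ^ 2 := Nat.mul_pos hM (Finset.prod_pos fun q hq =>
    pow_pos (hS q hq).pos 2)
  have h := hasDensity_of_periodic hpos key.1
  rw [key.2] at h
  convert h using 1
  push_cast
  rw [Finset.prod_div_distrib, div_mul_div_comm, one_mul]

end Density

section Sieve

open Filter

/-- The limit of the Euler product of `1 - p⁻²` over the primes outside `E`. -/
noncomputable def eulerLimit (E : Finset ℕ) : ℝ :=
  6 / Real.pi ^ 2 / ∏ p ∈ E, (1 - 1 / (p : ℝ) ^ 2)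

/-- The integers `n` for which `n + a` is divisible by the square of a prime outside `E`. -/
def squareHits (E : Finset ℕ) (a : ℕ) : Set ℕ :=
  {n | ∃ p, p.Prime ∧ p ∉ E ∧ p ^ 2 ∣ n + a}

lemma one_sub_inv_sq_pos {p : ℕ} (hp : p.Prime) : 0 < 1 - 1 / (p : ℝ) ^ 2 := by
  have h : (2 : ℝ) ≤ p := by exact_mod_cast hp.two_le
  rw [sub_pos, div_lt_one (by positivity)]
  nlinarith

lemma tendsto_prod_primesBelow :
    Tendsto (fun N : ℕ => ∏ p ∈ N.primesBelow, (1 - 1 / (p : ℝ) ^ 2)) atTop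
      (𝓝 (6 / Real.pi ^ 2)) := by
  let f : ℕ →*₀ ℝ :=
    { toFun := fun n => 1 / (n : ℝ) ^ 2
      map_zero' := by simp
      map_one' := by simp
      map_mul' := fun m n => by push_cast; rw [mul_pow, one_div_mul_one_div] }
  have hs : Summable fun n => ‖f n‖ := by
    have := hasSum_zeta_two.summable
    refine this.congr fun n => ?_
    change _ = ‖1 / (n : ℝ) ^ 2‖
    rw [Real.norm_of_nonneg (by positivity)]
  have h := (EulerProduct.eulerProduct_completely_multiplicative hs).inv₀
    (by rw [show ∑' n, f n = Real.pi ^ 2 / 6 from hasSum_zeta_two.tsum_eq]; positivity)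
  rw [show ∑' n, f n = Real.pi ^ 2 / 6 from hasSum_zeta_two.tsum_eq, inv_div] at h
  refine h.congr fun n => ?_
  rw [Finset.prod_inv_distrib, inv_inv]
  rfl

lemma tendsto_prod_primesBelow_sdiff {E : Finset ℕ} (hE : ∀ p ∈ E, p.Prime) :
    Tendsto (fun N : ℕ => ∏ p ∈ N.primesBelow \ E, (1 - 1 / (p : ℝ) ^ 2)) atTop
      (𝓝 (eulerLimit E)) := by
  refine (tendsto_prod_primesBelow.div_const (∏ p ∈ E, (1 - 1 / (p : ℝ) ^ 2))).congr' ?_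
  filter_upwards [eventually_gt_atTop (E.sup id)] with N hN
  have hsub : E ⊆ N.primesBelow := fun p hp =>
    Nat.mem_primesBelow.2 ⟨(Finset.le_sup (f := id) hp).trans_lt hN, hE p hp⟩
  have h0 : ∏ p ∈ E, (1 - 1 / (p : ℝ) ^ 2) ≠ 0 :=
    Finset.prod_ne_zero_iff.2 fun p hp => (one_sub_inv_sq_pos (hE p hp)).ne'
  rw [← Finset.prod_sdiff hsub, mul_div_assoc, div_self h0, mul_one]

open Classical in
lemma card_filter_dvd_add_le (a x q : ℕ) :
    ((Finset.Icc 1 x).filter fun n => q ∣ n + a).card ≤ (x + a) / q := by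
  rw [← Nat.Ioc_filter_dvd_card_eq_div]
  refine Finset.card_le_card_of_injOn (fun n => n + a) ?_ ((add_left_injective a).injOn)
  intro n hn
  simp only [Finset.coe_filter, Finset.mem_Icc, Set.mem_ofPred_eq, Finset.mem_Ioc] at hn ⊢
  exact ⟨⟨by omega, by omega⟩, hn.2⟩

open Classical in
lemma upperDensity_squares_tail (N a : ℕ) (hN : 0 < N) :
    upperDensity {n | ∃ p, N ≤ p ∧ p ^ 2 ∣ n + a} ≤ 2 / N := by
  have hN' : (0 : ℝ) < N := by exact_mod_cast hN
  have key : ∀ x : ℕ, 0 < x →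
      densityUpTo {n | ∃ p, N ≤ p ∧ p ^ 2 ∣ n + a} x ≤ 2 / N + (a * (2 / N)) / x := by
    intro x hx
    have hx' : (0 : ℝ) < x := by exact_mod_cast hx
    have hsub : {n | ∃ p, N ≤ p ∧ p ^ 2 ∣ n + a} ∩ Set.Icc 1 x ⊆
        (((Finset.Ioo (N - 1) (x + a + 1)).biUnion fun p =>
          (Finset.Icc 1 x).filter fun n => p ^ 2 ∣ n + a : Finset ℕ) : Set ℕ) := by
      rintro n ⟨⟨p, hp, hd⟩, hn⟩
      simp only [Finset.coe_biUnion, Set.mem_iUnion, Finset.coe_filter, Finset.mem_Icc,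
        Set.mem_ofPred_eq, Finset.coe_Ioo, Set.mem_Ioo]
      have h1 := Nat.le_of_dvd (by have := hn.1; omega) hd
      have h2 : p ≤ p ^ 2 := Nat.le_self_pow two_ne_zero p
      have h3 := hn.2
      exact ⟨p, ⟨by omega, by omega⟩, ⟨hn.1, hn.2⟩, hd⟩
    have h1 := Set.ncard_le_ncard hsub (Finset.finite_toSet _)
    rw [Set.ncard_coe_finset] at h1
    have h2 := h1.trans Finset.card_biUnion_le
    have h3 : (({n | ∃ p, N ≤ p ∧ p ^ 2 ∣ n + a} ∩ Set.Icc 1 x).ncard : ℝ)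
        ≤ (x + a) * (2 / N) := by
      calc (({n | ∃ p, N ≤ p ∧ p ^ 2 ∣ n + a} ∩ Set.Icc 1 x).ncard : ℝ)
          ≤ ∑ p ∈ Finset.Ioo (N - 1) (x + a + 1),
              (((Finset.Icc 1 x).filter fun n => p ^ 2 ∣ n + a).card : ℝ) := by exact_mod_cast h2
        _ ≤ ∑ p ∈ Finset.Ioo (N - 1) (x + a + 1), (x + a : ℝ) * ((p : ℝ) ^ 2)⁻¹ := by
            refine Finset.sum_le_sum fun p _ => ?_
            have h4 : (((Finset.Icc 1 x).filter fun n => p ^ 2 ∣ n + a).card : ℝ)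
                ≤ ((x + a) / p ^ 2 : ℕ) := by exact_mod_cast card_filter_dvd_add_le a x (p ^ 2)
            refine h4.trans (Nat.cast_div_le.trans (le_of_eq ?_))
            push_cast
            rw [div_eq_mul_inv]
        _ ≤ (x + a) * (2 / N) := by
            rw [← Finset.mul_sum]
            gcongr
            have h5 := sum_Ioo_inv_sq_le (α := ℝ) (N - 1) (x + a + 1)
            have h6 : ((N - 1 : ℕ) : ℝ) + 1 = N := by
              exact_mod_cast Nat.sub_add_cancel hN
            rwa [h6] at h5
    unfold densityUpTo
    rw [div_le_iff₀ hx']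
    refine h3.trans (le_of_eq ?_)
    field_simp
  refine upperDensity_le fun ε hε => ?_
  have ht := tendsto_const_div_atTop_nhds_zero_nat ((a : ℝ) * (2 / N))
  filter_upwards [ht.eventually_lt_const hε, eventually_gt_atTop 0] with x h1 h2
  linarith [key x h2]

lemma count_dvd_add {m : ℕ} (hm : 0 < m) (a : ℕ) : Nat.count (fun n => m ∣ n + a) m = 1 := by
  have h : (fun n => m ∣ n + a) = fun n => n ≡ (m - 1) * a [MOD m] := by
    funext n
    have h1 : (m - 1) * a + a = m * a := by
      obtain ⟨k, rfl⟩ : ∃ k, m = k + 1 := ⟨m - 1, by omega⟩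
      simp; ring
    have h2 : (m - 1) * a + a ≡ 0 [MOD m] := by
      rw [h1]; exact (Nat.modEq_zero_iff_dvd.2 (dvd_mul_right m a))
    refine propext ⟨fun h => ?_, fun h => ?_⟩
    · exact Nat.ModEq.add_right_cancel' a ((Nat.modEq_zero_iff_dvd.2 h).trans h2.symm)
    · exact Nat.modEq_zero_iff_dvd.1 ((h.add_right a).trans h2)
  simp only [h]
  rw [Nat.count_modEq_card _ hm]
  simp [Nat.div_self hm]

lemma count_not_dvd_add {m : ℕ} (hm : 0 < m) (a : ℕ) :
    Nat.count (fun n => ¬ m ∣ n + a) m = m - 1 := by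
  have h1 := count_dvd_add hm a
  rw [Nat.count_eq_card_filter_range] at h1 ⊢
  have h2 := Finset.card_filter_add_card_filter_not (s := Finset.range m) (fun n => m ∣ n + a)
  rw [Finset.card_range] at h2
  omega

lemma count_not_dvd_add_and_le {m : ℕ} (hm : 0 < m) (a b : ℕ) :
    Nat.count (fun n => ¬ m ∣ n + a ∧ ¬ m ∣ n + b) m ≤ m - 1 := by
  rw [← count_not_dvd_add hm a]
  rw [Nat.count_eq_card_filter_range, Nat.count_eq_card_filter_range]
  exact Finset.card_le_card (Finset.monotone_filter_right _ fun n _ h => h.1)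

lemma count_not_dvd_add_and {m : ℕ} (hm : 0 < m) {a b : ℕ} (hab : ¬ a ≡ b [MOD m]) :
    Nat.count (fun n => ¬ m ∣ n + a ∧ ¬ m ∣ n + b) m + 2 = m := by
  have h1 := count_dvd_add hm a
  have h2 := count_dvd_add hm b
  rw [Nat.count_eq_card_filter_range] at h1 h2 ⊢
  have h3 := Finset.card_filter_add_card_filter_not (s := Finset.range m)
    (fun n => m ∣ n + a ∨ m ∣ n + b)
  rw [Finset.card_range, Finset.filter_or, Finset.card_union_of_disjoint, h1, h2] at h3
  · simp only [not_or] at h3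
    omega
  · rw [Finset.disjoint_filter]
    intro n _ ha hb
    refine hab (Nat.ModEq.add_left_cancel' n ?_)
    exact (Nat.modEq_zero_iff_dvd.2 ha).trans (Nat.modEq_zero_iff_dvd.2 hb).symm

lemma periodic_not_dvd_add (m a : ℕ) : Function.Periodic (fun n => ¬ m ∣ n + a) m := fun n => by
  simp only [eq_iff_iff, not_iff_not]
  rw [show n + m + a = n + a + m by ring]
  exact Nat.dvd_add_self_right

lemma hasDensity_modEq {M : ℕ} (hM : 0 < M) (s : ℕ) : HasDensity {n | n ≡ s [MOD M]} (1 / M) := by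
  simpa using hasDensity_sieve (s := s) hM (S := ∅) (Q := fun _ _ => True)
    (by simp) (by simp) (by simp)

lemma hasDensity_not_dvd {M : ℕ} (hM : 0 < M) (s a : ℕ) {S : Finset ℕ}
    (hS : ∀ p ∈ S, p.Prime) (hMS : ∀ p ∈ S, M.Coprime p) :
    HasDensity {n | n ≡ s [MOD M] ∧ ∀ p ∈ S, ¬ p ^ 2 ∣ n + a}
      (1 / M * ∏ p ∈ S, (1 - 1 / (p : ℝ) ^ 2)) := by
  have h := hasDensity_sieve (s := s) hM (Q := fun p n => ¬ p ^ 2 ∣ n + a) hS hMS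
    (fun p _ => periodic_not_dvd_add _ a)
  convert h using 2
  refine Finset.prod_congr rfl fun p hp => ?_
  have hp2 : 0 < p ^ 2 := pow_pos (hS p hp).pos 2
  rw [count_not_dvd_add hp2, Nat.cast_sub hp2]
  have : (p : ℝ) ≠ 0 := by exact_mod_cast (hS p hp).ne_zero
  push_cast
  field_simp

lemma HasDensity.exists_le_of_not_dvd_pair {M : ℕ} (hM : 0 < M) (s a b : ℕ) {S D : Finset ℕ}
    (hS : ∀ p ∈ S, p.Prime) (hMS : ∀ p ∈ S, M.Coprime p) (hDS : D ⊆ S)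
    (hD : ∀ p ∈ D, ¬ a ≡ b [MOD p ^ 2]) :
    ∃ d, HasDensity {n | n ≡ s [MOD M] ∧ ∀ p ∈ S, ¬ p ^ 2 ∣ n + a ∧ ¬ p ^ 2 ∣ n + b} d ∧
      d ≤ 1 / M * ((∏ p ∈ S, (1 - 1 / (p : ℝ) ^ 2)) *
        ∏ p ∈ D, ((p : ℝ) ^ 2 - 2) / ((p : ℝ) ^ 2 - 1)) := by
  classical
  refine ⟨_, hasDensity_sieve (s := s) hM (Q := fun p n => ¬ p ^ 2 ∣ n + a ∧ ¬ p ^ 2 ∣ n + b) hS hMS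
    (fun p _ n => ?_), ?_⟩
  · have h1 := periodic_not_dvd_add (p ^ 2) a n
    have h2 := periodic_not_dvd_add (p ^ 2) b n
    simp only at h1 h2 ⊢
    rw [h1, h2]
  · have e : ∏ p ∈ D, ((p : ℝ) ^ 2 - 2) / ((p : ℝ) ^ 2 - 1)
        = ∏ p ∈ S, if p ∈ D then ((p : ℝ) ^ 2 - 2) / ((p : ℝ) ^ 2 - 1) else 1 := by
      rw [Finset.prod_ite_mem, Finset.inter_eq_right.2 hDS]
    rw [e, ← Finset.prod_mul_distrib]
    gcongr with p hp
    have hp2 : 0 < p ^ 2 := pow_pos (hS p hp).pos 2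
    have h2 : (2 : ℝ) ≤ p := by exact_mod_cast (hS p hp).two_le
    have h4 : (0 : ℝ) < (p : ℝ) ^ 2 - 1 := by nlinarith
    have h0 : (0 : ℝ) < (p : ℝ) ^ 2 := by positivity
    split_ifs with hpD
    · have h5 := count_not_dvd_add_and hp2 (hD p hpD)
      have h6 : (Nat.count (fun n => ¬ p ^ 2 ∣ n + a ∧ ¬ p ^ 2 ∣ n + b) (p ^ 2) : ℝ)
          = (p : ℝ) ^ 2 - 2 := by
        rw [eq_sub_iff_add_eq]; exact_mod_cast h5
      rw [h6]
      apply le_of_eq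
      field_simp
    · have h5 := count_not_dvd_add_and_le hp2 a b
      have h6 : (Nat.count (fun n => ¬ p ^ 2 ∣ n + a ∧ ¬ p ^ 2 ∣ n + b) (p ^ 2) : ℝ)
          ≤ (p : ℝ) ^ 2 - 1 := by
        rw [le_sub_iff_add_le]; exact_mod_cast (by omega)
      rw [mul_one, one_sub_div h0.ne']
      exact div_le_div_of_nonneg_right h6 h0.le

lemma upperDensity_squareHits_pair {M : ℕ} (hM : 0 < M) (s a b : ℕ) {E D : Finset ℕ}
    (hE : ∀ p ∈ E, p.Prime) (hME : ∀ p, p.Prime → p ∉ E → M.Coprime p)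
    (hDp : ∀ p ∈ D, p.Prime ∧ p ∉ E) (hD : ∀ p ∈ D, ¬ a ≡ b [MOD p ^ 2]) :
    upperDensity ({n | n ≡ s [MOD M]} ∩ (squareHits E a ∩ squareHits E b)) ≤
      1 / M * (1 - 2 * eulerLimit E
        + eulerLimit E * ∏ p ∈ D, ((p : ℝ) ^ 2 - 2) / ((p : ℝ) ^ 2 - 1)) := by
  set c := ∏ p ∈ D, ((p : ℝ) ^ 2 - 2) / ((p : ℝ) ^ 2 - 1) with hc
  have hlim : Tendsto (fun N : ℕ => 1 / (M : ℝ) * (1 - 2 * ∏ p ∈ N.primesBelow \ E, (1 - 1 / (p : ℝ) ^ 2)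
      + (∏ p ∈ N.primesBelow \ E, (1 - 1 / (p : ℝ) ^ 2)) * c) + (2 / (N : ℝ) + 2 / (N : ℝ))) atTop
      (𝓝 (1 / (M : ℝ) * (1 - 2 * eulerLimit E + eulerLimit E * c) + (0 + 0))) := by
    have h1 := tendsto_prod_primesBelow_sdiff hE
    have h2 := tendsto_const_div_atTop_nhds_zero_nat (2 : ℝ)
    exact ((((h1.const_mul 2).const_sub 1).add (h1.mul_const c)).const_mul _).add (h2.add h2)
  rw [add_zero, add_zero] at hlim
  refine ge_of_tendsto hlim ?_
  filter_upwards [eventually_gt_atTop (D.sup id), eventually_gt_atTop 0] with N hN hN0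
  set S := N.primesBelow \ E with hSdef
  have hS : ∀ p ∈ S, p.Prime := fun p hp =>
    (Nat.mem_primesBelow.1 (Finset.mem_sdiff.1 hp).1).2
  have hMS : ∀ p ∈ S, M.Coprime p := fun p hp => hME p (hS p hp) (Finset.mem_sdiff.1 hp).2
  have hDS : D ⊆ S := fun p hp => Finset.mem_sdiff.2
    ⟨Nat.mem_primesBelow.2 ⟨(Finset.le_sup (f := id) hp).trans_lt hN, (hDp p hp).1⟩, (hDp p hp).2⟩
  obtain ⟨d, hd, hdle⟩ := HasDensity.exists_le_of_not_dvd_pair hM s a b hS hMS hDS hD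
  have hX := hasDensity_modEq hM s
  have hYa := hasDensity_not_dvd hM s a hS hMS
  have hYb := hasDensity_not_dvd hM s b hS hMS
  have hZ := (hX.sdiff hYa (fun n hn => hn.1)).sdiff
    (hYb.sdiff hd (fun n hn => ⟨hn.1, fun p hp => (hn.2 p hp).2⟩)) (by
      rintro n ⟨h1, h2⟩
      exact ⟨h1.1, fun h3 => h2 ⟨h1.1, fun p hp => ⟨h3.2 p hp, h1.2 p hp⟩⟩⟩)
  have ht := upperDensity_squares_tail N a hN0
  have ht' := upperDensity_squares_tail N b hN0
  refine le_trans (upperDensity_mono (B := _ ∪ ({n | ∃ p, N ≤ p ∧ p ^ 2 ∣ n + a} ∪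
    {n | ∃ p, N ≤ p ∧ p ^ 2 ∣ n + b})) ?_) ((upperDensity_union_le _ _).trans
      (add_le_add (le_of_eq hZ.upperDensity_eq) ((upperDensity_union_le _ _).trans
        (add_le_add ht ht')))) |>.trans ?_
  · rintro n ⟨hn, ⟨p, hp, hpE, hpd⟩, ⟨q, hq, hqE, hqd⟩⟩
    by_cases h1 : N ≤ p
    · exact Or.inr (Or.inl ⟨p, h1, hpd⟩)
    by_cases h2 : N ≤ q
    · exact Or.inr (Or.inr ⟨q, h2, hqd⟩)
    have hpS : p ∈ S := Finset.mem_sdiff.2 ⟨Nat.mem_primesBelow.2 ⟨by omega, hp⟩, hpE⟩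
    have hqS : q ∈ S := Finset.mem_sdiff.2 ⟨Nat.mem_primesBelow.2 ⟨by omega, hq⟩, hqE⟩
    exact Or.inl ⟨⟨hn, fun h => h.2 p hpS hpd⟩, fun h => h.1.2 q hqS hqd⟩
  · nlinarith

lemma upperDensity_squareHits {M : ℕ} (hM : 0 < M) (s a : ℕ) {E : Finset ℕ}
    (hE : ∀ p ∈ E, p.Prime) (hME : ∀ p, p.Prime → p ∉ E → M.Coprime p) :
    upperDensity ({n | n ≡ s [MOD M]} ∩ squareHits E a) ≤ 1 / M * (1 - eulerLimit E) := by
  have h := upperDensity_squareHits_pair hM s a a (D := ∅) hE hME (by simp) (by simp)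
  rw [Set.inter_self] at h
  refine h.trans (le_of_eq ?_)
  rw [Finset.prod_empty]; ring

end Sieve

section Classes

open Filter

lemma eulerLimit_two : eulerLimit {2} = 8 / Real.pi ^ 2 := by
  have := Real.pi_pos.ne'
  simp only [eulerLimit, Finset.prod_singleton]
  push_cast
  field_simp
  norm_num

lemma eulerLimit_two_insert {p : ℕ} (h2 : p ≠ 2) :
    eulerLimit {2, p} = 8 / Real.pi ^ 2 / (1 - 1 / (p : ℝ) ^ 2) := by
  rw [← eulerLimit_two, eulerLimit, eulerLimit, Finset.prod_pair h2.symm, Finset.prod_singleton,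
    div_div, div_div, div_div]

lemma eight_div_pi_sq_bounds : 0.8105 < 8 / Real.pi ^ 2 ∧ 8 / Real.pi ^ 2 < 0.8106 := by
  have h1 := Real.pi_gt_d6
  have h2 := Real.pi_lt_d6
  constructor
  · rw [lt_div_iff₀ (by positivity)]; nlinarith
  · rw [div_lt_iff₀ (by positivity)]; nlinarith

/-- The elements of `A` in the residue class of `i` modulo four. -/
def residueClass (A : Set ℕ) (i : Fin 4) : Set ℕ := {n | n ∈ A ∧ n % 4 = i}

/-- The density of a set relative to a residue class modulo four containing it. -/
noncomputable def relDensity (S : Set ℕ) : ℝ := 4 * upperDensity S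

/-- All elements of `S` are congruent modulo `m`. -/
def ConstMod (S : Set ℕ) (m : ℕ) : Prop := ∀ a ∈ S, ∀ b ∈ S, a ≡ b [MOD m]

lemma relDensity_empty : relDensity ∅ = 0 := by simp [relDensity, upperDensity_empty]

lemma ConstMod.mul {S : Set ℕ} {m k : ℕ} (hm : ConstMod S m) (hk : ConstMod S k)
    (h : m.Coprime k) : ConstMod S (m * k) := fun a ha b hb =>
  (Nat.modEq_and_modEq_iff_modEq_mul h).1 ⟨hm a ha b hb, hk a ha b hb⟩

lemma constMod_four_residueClass (A : Set ℕ) (i : Fin 4) : ConstMod (residueClass A i) 4 :=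
  fun _ ha _ hb => ha.2.trans hb.2.symm

lemma relDensity_le_of_constMod {S : Set ℕ} {m : ℕ} (h4 : ConstMod S 4) (hm : ConstMod S m)
    (hodd : Nat.Coprime 4 m) (hpos : 0 < m) : relDensity S ≤ 1 / m := by
  rcases S.eq_empty_or_nonempty with rfl | ⟨a, ha⟩
  · rw [relDensity_empty]; positivity
  · have h1 : upperDensity S ≤ 1 / ((4 * m : ℕ) : ℝ) := by
      rw [← (hasDensity_modEq (M := 4 * m) (by omega) a).upperDensity_eq]
      exact upperDensity_mono fun n hn => h4.mul hm hodd n hn a ha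
    have : (0 : ℝ) < m := by exact_mod_cast hpos
    unfold relDensity
    calc 4 * upperDensity S ≤ 4 * (1 / ((4 * m : ℕ) : ℝ)) := by gcongr
      _ = 1 / m := by push_cast; field_simp

lemma upperDensity_le_sum_relDensity (A : Set ℕ) :
    4 * upperDensity A ≤ relDensity (residueClass A 0) + relDensity (residueClass A 1)
      + relDensity (residueClass A 2) + relDensity (residueClass A 3) := by
  have h : A ⊆ ((residueClass A 0 ∪ residueClass A 1) ∪ residueClass A 2) ∪ residueClass A 3 := by
    intro n hn
    have h4 : n % 4 = 0 ∨ n % 4 = 1 ∨ n % 4 = 2 ∨ n % 4 = 3 := by omega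
    rcases h4 with h | h | h | h
    · exact Or.inl (Or.inl (Or.inl ⟨hn, h⟩))
    · exact Or.inl (Or.inl (Or.inr ⟨hn, h⟩))
    · exact Or.inl (Or.inr ⟨hn, h⟩)
    · exact Or.inr ⟨hn, h⟩
  have h1 := upperDensity_mono h
  have h2 := upperDensity_union_le (((residueClass A 0 ∪ residueClass A 1) ∪ residueClass A 2))
    (residueClass A 3)
  have h3 := upperDensity_union_le ((residueClass A 0 ∪ residueClass A 1)) (residueClass A 2)
  have h4 := upperDensity_union_le (residueClass A 0) (residueClass A 1)
  unfold relDensity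
  linarith

lemma AvoidsSquarefree.mem_squareHits {A : Set ℕ} (hA : AvoidsSquarefree (A + A)) {i j : Fin 4}
    (hij : i + j ≠ 0) {a b : ℕ} (ha : a ∈ residueClass A i) (hb : b ∈ residueClass A j) :
    a ∈ squareHits {2} b := by
  have h := hA (a + b) (Set.add_mem_add ha.1 hb.1)
  rw [Nat.squarefree_iff_prime_squarefree] at h
  push Not at h
  obtain ⟨p, hp, hd⟩ := h
  refine ⟨p, hp, ?_, by rwa [pow_two]⟩
  rw [Finset.mem_singleton]
  rintro rfl
  apply hij
  have h1 := ha.2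
  have h2 := hb.2
  ext
  rw [Fin.val_add, Fin.val_zero]
  omega

lemma coprime_four_of_prime {p : ℕ} (hp : p.Prime) (h : p ≠ 2) : Nat.Coprime 4 p := by
  rw [show (4 : ℕ) = 2 ^ 2 by norm_num]
  exact Nat.Coprime.pow_left 2 ((Nat.coprime_primes Nat.prime_two hp).2 h.symm)

lemma relDensity_le_of_pair {A : Set ℕ} (hA : AvoidsSquarefree (A + A)) {i j : Fin 4}
    (hij : i + j ≠ 0) {a b : ℕ} (ha : a ∈ residueClass A j) (hb : b ∈ residueClass A j)
    {D : Finset ℕ} (hDp : ∀ p ∈ D, p.Prime ∧ p ≠ 2) (hD : ∀ p ∈ D, ¬ a ≡ b [MOD p ^ 2]) :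
    relDensity (residueClass A i) ≤ 1 - 2 * (8 / Real.pi ^ 2)
      + 8 / Real.pi ^ 2 * ∏ p ∈ D, ((p : ℝ) ^ 2 - 2) / ((p : ℝ) ^ 2 - 1) := by
  have h := upperDensity_squareHits_pair (M := 4) (by norm_num) i a b (E := {2}) (D := D)
    (by simpa using Nat.prime_two)
    (fun p hp hpE => coprime_four_of_prime hp (by simpa using hpE)) (by simpa using hDp) hD
  rw [eulerLimit_two] at h
  have h1 := (upperDensity_mono (A := residueClass A i) fun n hn =>
    Set.mem_inter (show n % 4 = i % 4 by rw [hn.2, Nat.mod_eq_of_lt i.2])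
      (Set.mem_inter (hA.mem_squareHits hij hn ha) (hA.mem_squareHits hij hn hb))).trans h
  unfold relDensity
  push_cast at h1
  linarith

lemma relDensity_le_of_class {A : Set ℕ} (hA : AvoidsSquarefree (A + A)) {i j : Fin 4}
    (hij : i + j ≠ 0) {p : ℕ} (hp : p.Prime) (hp2 : p ≠ 2)
    (hc : ConstMod (residueClass A i) (p ^ 2)) {a b : ℕ} (ha : a ∈ residueClass A i)
    (hb : b ∈ residueClass A j) (hab : ¬ p ^ 2 ∣ a + b) :
    relDensity (residueClass A i) ≤
      1 / (p : ℝ) ^ 2 * (1 - 8 / Real.pi ^ 2 / (1 - 1 / (p : ℝ) ^ 2)) := by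
  have h := upperDensity_squareHits (M := 4 * p ^ 2) (by have := hp.pos; positivity) a b
    (E := {2, p}) (by simp [Nat.prime_two, hp]) (fun q hq hqE => by
      simp only [Finset.mem_insert, Finset.mem_singleton, not_or] at hqE
      refine Nat.Coprime.mul_left (coprime_four_of_prime hq hqE.1) (Nat.Coprime.pow_left 2 ?_)
      exact (Nat.coprime_primes hp hq).2 (Ne.symm hqE.2))
  rw [eulerLimit_two_insert hp2] at h
  have h1 := (upperDensity_mono (A := residueClass A i) fun n hn =>
    Set.mem_inter ?_ ?_).trans h
  · have h0 : (p : ℝ) ≠ 0 := by exact_mod_cast hp.ne_zero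
    unfold relDensity
    push_cast at h1
    calc _ ≤ _ := mul_le_mul_of_nonneg_left h1 (by norm_num : (0 : ℝ) ≤ 4)
      _ = _ := by
        rw [← mul_assoc]; congr 1; field_simp
  · exact (constMod_four_residueClass A i).mul hc
      ((coprime_four_of_prime hp hp2).pow_right 2) n hn a ha
  · obtain ⟨q, hq, hq2, hd⟩ := hA.mem_squareHits hij hn hb
    refine ⟨q, hq, ?_, hd⟩
    simp only [Finset.mem_singleton, Finset.mem_insert, not_or] at hq2 ⊢
    refine ⟨hq2, ?_⟩
    rintro rfl
    apply hab
    exact ((hc n hn a ha).add_right b).dvd_iff dvd_rfl |>.1 hd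

lemma ConstMod.of_dvd_add {S : Set ℕ} {m a : ℕ} (h : ∀ b ∈ S, m ∣ a + b) : ConstMod S m :=
  fun b hb c hc => Nat.ModEq.add_left_cancel' a
    ((Nat.modEq_zero_iff_dvd.2 (h b hb)).trans (Nat.modEq_zero_iff_dvd.2 (h c hc)).symm)

lemma relDensity_le_of_constMod_of_not {A : Set ℕ} (hA : AvoidsSquarefree (A + A)) {i j : Fin 4}
    (hij : i + j ≠ 0) {p : ℕ} (hp : p.Prime) (hp2 : p ≠ 2)
    (hc : ConstMod (residueClass A i) (p ^ 2)) (hn : ¬ ConstMod (residueClass A j) (p ^ 2)) :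
    relDensity (residueClass A i) ≤
      max 0 (1 / (p : ℝ) ^ 2 * (1 - 8 / Real.pi ^ 2 / (1 - 1 / (p : ℝ) ^ 2))) := by
  rcases (residueClass A i).eq_empty_or_nonempty with h | ⟨a, ha⟩
  · rw [h, relDensity_empty]; exact le_max_left _ _
  · have : ∃ b ∈ residueClass A j, ¬ p ^ 2 ∣ a + b := by
      by_contra! h
      exact hn (ConstMod.of_dvd_add h)
    obtain ⟨b, hb, hab⟩ := this
    exact (relDensity_le_of_class hA hij hp hp2 hc ha hb hab).trans (le_max_right _ _)

/-- If no two points of `S` differ in all three coordinates, and no coordinate is constant on `S`,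
then `S` is contained in a union of four sets on which two coordinates are fixed. -/
lemma exists_cover_of_no_pair {ι α : Type*} {S : Set ι} {f g h : ι → α}
    (hf : ∃ a ∈ S, ∃ b ∈ S, f a ≠ f b) (hg : ∃ a ∈ S, ∃ b ∈ S, g a ≠ g b)
    (hh : ∃ a ∈ S, ∃ b ∈ S, h a ≠ h b)
    (hS : ∀ a ∈ S, ∀ b ∈ S, f a = f b ∨ g a = g b ∨ h a = h b) :
    ∃ x x' y y' w, ∀ n ∈ S, (f n = x ∧ h n = w) ∨ (g n = y' ∧ h n = w) ∨ (f n = x ∧ g n = y') ∨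
      (f n = x' ∧ g n = y) := by
  obtain ⟨a, ha, b, hb, hab, hab'⟩ : ∃ a ∈ S, ∃ b ∈ S, f a ≠ f b ∧ g a ≠ g b := by
    obtain ⟨a, ha, b, hb, hab⟩ := hf
    obtain ⟨c, hc, d, hd, hcd⟩ := hg
    by_contra! H
    have h1 := H a ha b hb hab
    have h2 : ∃ e ∈ S, g e ≠ g a := by
      by_cases hca : g c = g a
      · exact ⟨d, hd, fun h => hcd (hca.trans h.symm)⟩
      · exact ⟨c, hc, hca⟩
    obtain ⟨e, he, hea⟩ := h2
    by_cases h3 : f e = f a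
    · exact hea ((H e he b hb (by rw [h3]; exact hab)).trans h1.symm)
    · exact hea (H e he a ha h3)
  have hw : h a = h b := by
    rcases hS a ha b hb with h1 | h1 | h1
    · exact absurd h1 hab
    · exact absurd h1 hab'
    · exact h1
  obtain ⟨c, hc, hca⟩ : ∃ c ∈ S, h c ≠ h a := by
    obtain ⟨c, hc, d, hd, hcd⟩ := hh
    by_cases h1 : h c = h a
    · exact ⟨d, hd, fun h2 => hcd (h1.trans h2.symm)⟩
    · exact ⟨c, hc, h1⟩
  have hcb : h c ≠ h b := hw ▸ hca
  by_cases h1 : f c = f a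
  · have h2 : g c = g b := by
      rcases hS c hc b hb with h | h | h
      · exact absurd (h1.symm.trans h) hab
      · exact h
      · exact absurd h hcb
    refine ⟨f a, f b, g a, g b, h a, fun n hn => ?_⟩
    have e1 := hS n hn a ha
    have e2 := hS n hn b hb
    have e3 := hS n hn c hc
    grind
  · have h2 : g c = g a := by
      rcases hS c hc a ha with h | h | h
      · exact absurd h h1
      · exact h
      · exact absurd h hca
    have h3 : f c = f b := by
      rcases hS c hc b hb with h | h | h
      · exact h
      · exact absurd (h2.symm.trans h) hab'
      · exact absurd h hcb
    refine ⟨f b, f a, g b, g a, h a, fun n hn => ?_⟩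
    have e1 := hS n hn a ha
    have e2 := hS n hn b hb
    have e3 := hS n hn c hc
    grind

lemma relDensity_mono {S T : Set ℕ} (h : S ⊆ T) : relDensity S ≤ relDensity T :=
  mul_le_mul_of_nonneg_left (upperDensity_mono h) (by norm_num)

lemma relDensity_union_le (S T : Set ℕ) : relDensity (S ∪ T) ≤ relDensity S + relDensity T := by
  unfold relDensity
  linarith [upperDensity_union_le S T]

lemma relDensity_fix_two_le {S : Set ℕ} (h4 : ConstMod S 4) {m k : ℕ} (x y : ℕ)
    (hm : Nat.Coprime 4 m) (hk : Nat.Coprime 4 k) (hmk : m.Coprime k) (hm0 : 0 < m) (hk0 : 0 < k) :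
    relDensity {n | n ∈ S ∧ n % m = x ∧ n % k = y} ≤ 1 / ((m : ℝ) * k) := by
  rw [← Nat.cast_mul]
  refine relDensity_le_of_constMod (fun a ha b hb => h4 a ha.1 b hb.1)
    (ConstMod.mul (fun a ha b hb => ?_) (fun a ha b hb => ?_) hmk) (hm.mul_right hk)
    (Nat.mul_pos hm0 hk0)
  · exact ha.2.1.trans hb.2.1.symm
  · exact ha.2.2.trans hb.2.2.symm

lemma exists_pair_of_not_constMod {S : Set ℕ} (h4 : ConstMod S 4) (h9 : ¬ ConstMod S 9)
    (h25 : ¬ ConstMod S 25) (hS : 0.0205 < relDensity S) :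
    ∃ a ∈ S, ∃ b ∈ S, ¬ a ≡ b [MOD 9] ∧ ¬ a ≡ b [MOD 25] ∧ ¬ a ≡ b [MOD 49] := by
  have h49 : ¬ ConstMod S 49 := fun h => by
    have := relDensity_le_of_constMod h4 h (by norm_num) (by norm_num)
    simp only [Nat.cast_ofNat] at this
    linarith
  by_contra! H
  simp only [ConstMod, not_forall] at h9 h25 h49
  obtain ⟨x, x', y, y', w, hc⟩ := exists_cover_of_no_pair (S := S) (f := fun n => n % 9)
    (g := fun n => n % 25) (h := fun n => n % 49)
    (by obtain ⟨a, ha, b, hb, h⟩ := h9; exact ⟨a, ha, b, hb, h⟩)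
    (by obtain ⟨a, ha, b, hb, h⟩ := h25; exact ⟨a, ha, b, hb, h⟩)
    (by obtain ⟨a, ha, b, hb, h⟩ := h49; exact ⟨a, ha, b, hb, h⟩)
    (fun a ha b hb => by
      by_contra! h
      exact h.2.2 (H a ha b hb h.1 h.2.1))
  have hsub : S ⊆ {n | n ∈ S ∧ n % 9 = x ∧ n % 49 = w} ∪ ({n | n ∈ S ∧ n % 25 = y' ∧ n % 49 = w} ∪
      ({n | n ∈ S ∧ n % 9 = x ∧ n % 25 = y'} ∪ {n | n ∈ S ∧ n % 9 = x' ∧ n % 25 = y})) :=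
    fun n hn => (hc n hn).imp (fun h => ⟨hn, h⟩) fun h => h.imp (fun h => ⟨hn, h⟩)
      fun h => h.imp (fun h => ⟨hn, h⟩) fun h => ⟨hn, h⟩
  have e0 := relDensity_mono hsub
  have e1 := relDensity_union_le {n | n ∈ S ∧ n % 9 = x ∧ n % 49 = w}
    ({n | n ∈ S ∧ n % 25 = y' ∧ n % 49 = w} ∪
      ({n | n ∈ S ∧ n % 9 = x ∧ n % 25 = y'} ∪ {n | n ∈ S ∧ n % 9 = x' ∧ n % 25 = y}))
  have e2 := relDensity_union_le {n | n ∈ S ∧ n % 25 = y' ∧ n % 49 = w}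
      ({n | n ∈ S ∧ n % 9 = x ∧ n % 25 = y'} ∪ {n | n ∈ S ∧ n % 9 = x' ∧ n % 25 = y})
  have e3 := relDensity_union_le {n | n ∈ S ∧ n % 9 = x ∧ n % 25 = y'}
    {n | n ∈ S ∧ n % 9 = x' ∧ n % 25 = y}
  have d1 := relDensity_fix_two_le h4 (m := 9) (k := 49) x w (by norm_num) (by norm_num)
    (by norm_num) (by norm_num) (by norm_num)
  have d2 := relDensity_fix_two_le h4 (m := 25) (k := 49) y' w (by norm_num) (by norm_num)
    (by norm_num) (by norm_num) (by norm_num)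
  have d3 := relDensity_fix_two_le h4 (m := 9) (k := 25) x y' (by norm_num) (by norm_num)
    (by norm_num) (by norm_num) (by norm_num)
  have d4 := relDensity_fix_two_le h4 (m := 9) (k := 25) x' y (by norm_num) (by norm_num)
    (by norm_num) (by norm_num) (by norm_num)
  simp only [Nat.cast_ofNat] at d1 d2 d3 d4
  linarith

end Classes

section UpperBounds

open Filter

variable {A : Set ℕ}

lemma relDensity_le_of_mem (hA : AvoidsSquarefree (A + A)) {i j : Fin 4} (hij : i + j ≠ 0)
    (hj : (residueClass A j).Nonempty) :
    relDensity (residueClass A i) ≤ 1 - 8 / Real.pi ^ 2 := by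
  obtain ⟨a, ha⟩ := hj
  have h := relDensity_le_of_pair hA hij ha ha (D := ∅) (by simp) (by simp)
  rw [Finset.prod_empty] at h
  linarith

lemma relDensity_le_of_not_constMod_sq (hA : AvoidsSquarefree (A + A)) {i j : Fin 4}
    (hij : i + j ≠ 0) {p : ℕ} (hp : p.Prime) (hp2 : p ≠ 2)
    (hj : ¬ ConstMod (residueClass A j) (p ^ 2)) :
    relDensity (residueClass A i) ≤ 1 - 2 * (8 / Real.pi ^ 2)
      + 8 / Real.pi ^ 2 * (((p : ℝ) ^ 2 - 2) / ((p : ℝ) ^ 2 - 1)) := by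
  simp only [ConstMod, not_forall] at hj
  obtain ⟨a, ha, b, hb, hab⟩ := hj
  simpa using relDensity_le_of_pair hA hij ha hb (D := {p}) (by simp [hp, hp2]) (by simpa using hab)

lemma relDensity_le_of_not_constMod_nine (hA : AvoidsSquarefree (A + A)) {i j : Fin 4}
    (hij : i + j ≠ 0) (hj : ¬ ConstMod (residueClass A j) 9) :
    relDensity (residueClass A i) ≤ 1 - 9 / 8 * (8 / Real.pi ^ 2) := by
  have h := relDensity_le_of_not_constMod_sq hA hij Nat.prime_three (by norm_num) hj
  generalize 8 / Real.pi ^ 2 = z at h ⊢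
  norm_num at h ⊢
  linarith

lemma relDensity_le_of_constMod_nine_of_not (hA : AvoidsSquarefree (A + A)) {i j : Fin 4}
    (hij : i + j ≠ 0) (hi : ConstMod (residueClass A i) 9)
    (hj : ¬ ConstMod (residueClass A j) 9) :
    relDensity (residueClass A i) ≤ (1 - 9 / 8 * (8 / Real.pi ^ 2)) / 9 := by
  have h := relDensity_le_of_constMod_of_not hA hij Nat.prime_three (by norm_num) hi hj
  obtain ⟨h1, h2⟩ := eight_div_pi_sq_bounds
  generalize 8 / Real.pi ^ 2 = z at h h1 h2 ⊢
  simp only [Nat.cast_ofNat] at h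
  refine h.trans (max_le ?_ ?_) <;> (norm_num at h1 h2 ⊢; linarith)

lemma relDensity_le_of_constMod_nine (hi : ConstMod (residueClass A i) 9) :
    relDensity (residueClass A i) ≤ 1 / 9 :=
  relDensity_le_of_constMod (m := 9) (constMod_four_residueClass A i) hi (by norm_num) (by norm_num)

lemma relDensity_le_of_constMod_twentyfive (hi : ConstMod (residueClass A i) 25) :
    relDensity (residueClass A i) ≤ 1 / 25 :=
  relDensity_le_of_constMod (m := 25) (constMod_four_residueClass A i) hi (by norm_num)
    (by norm_num)

lemma relDensity_le_of_constMod_twentyfive_of_not (hA : AvoidsSquarefree (A + A)) {i j : Fin 4}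
    (hij : i + j ≠ 0) (hi : ConstMod (residueClass A i) 25)
    (hj : ¬ ConstMod (residueClass A j) 25) :
    relDensity (residueClass A i) ≤ 0.0205 := by
  have h := relDensity_le_of_constMod_of_not hA hij Nat.prime_five (by norm_num) hi hj
  obtain ⟨h1, h2⟩ := eight_div_pi_sq_bounds
  generalize 8 / Real.pi ^ 2 = z at h h1 h2 ⊢
  simp only [Nat.cast_ofNat] at h
  refine h.trans (max_le (by norm_num) ?_)
  norm_num at h1 h2 ⊢
  linarith

/-- A class that is neither constant modulo `9` nor modulo `25` is sparse, or makes all the classes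
that it interacts with small. -/
lemma relDensity_le_or_forall_le (hA : AvoidsSquarefree (A + A)) {j : Fin 4}
    (h9 : ¬ ConstMod (residueClass A j) 9) (h25 : ¬ ConstMod (residueClass A j) 25) :
    relDensity (residueClass A j) ≤ 0.0205 ∨
      ∀ i, i + j ≠ 0 → relDensity (residueClass A i) ≤ 0.0445 := by
  rw [or_iff_not_imp_left, not_le]
  intro h i hij
  obtain ⟨a, ha, b, hb, e9, e25, e49⟩ :=
    exists_pair_of_not_constMod (constMod_four_residueClass A j) h9 h25 h
  have h := relDensity_le_of_pair hA hij ha hb (D := {3, 5, 7})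
    (by
      intro p hp
      simp only [Finset.mem_insert, Finset.mem_singleton] at hp
      rcases hp with rfl | rfl | rfl <;> norm_num)
    (by
      intro p hp
      simp only [Finset.mem_insert, Finset.mem_singleton] at hp
      rcases hp with rfl | rfl | rfl <;> assumption)
  rw [Finset.prod_insert (by decide), Finset.prod_pair (by decide)] at h
  obtain ⟨h1, h2⟩ := eight_div_pi_sq_bounds
  simp only [Nat.cast_ofNat] at h
  norm_num at h h1 h2 ⊢
  linarith

lemma relDensity_add_three_mul_le (hA : AvoidsSquarefree (A + A)) {i j : Fin 4}
    (hij : i + j ≠ 0) (hne : (residueClass A i).Nonempty) (hi : ConstMod (residueClass A i) 9)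
    (hj : ¬ ConstMod (residueClass A j) 9) :
    relDensity (residueClass A j) + 3 * relDensity (residueClass A i) ≤ 1 - 8 / Real.pi ^ 2 := by
  classical
  obtain ⟨z1, z2⟩ := eight_div_pi_sq_bounds
  have hji : j + i ≠ 0 := by rwa [add_comm]
  have h4 := constMod_four_residueClass A i
  by_cases hall : ∀ p : ℕ, p.Prime → p ≠ 2 → ConstMod (residueClass A i) (p ^ 2)
  · have h0 : relDensity (residueClass A i) ≤ 0 := by
      refine le_of_forall_pos_le_add fun ε hε => ?_
      obtain ⟨n, hn⟩ := exists_nat_gt (1 / ε)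
      obtain ⟨p, hpn, hp⟩ := Nat.exists_infinite_primes (n + 3)
      have h := relDensity_le_of_constMod h4 (hall p hp (by omega))
        ((coprime_four_of_prime hp (by omega)).pow_right 2) (pow_pos hp.pos 2)
      have h1 : (n : ℝ) ≤ ((p ^ 2 : ℕ) : ℝ) := by
        have : p ≤ p ^ 2 := Nat.le_self_pow two_ne_zero p
        exact_mod_cast (by omega : n ≤ p ^ 2)
      have h2 : 1 / ((p ^ 2 : ℕ) : ℝ) ≤ ε := by
        rw [div_le_comm₀ ((by positivity : 0 < 1 / ε).trans (hn.trans_le h1)) hε]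
        linarith
      linarith
    have := relDensity_le_of_mem hA hji hne
    linarith
  · have hex : ∃ p : ℕ, p.Prime ∧ p ≠ 2 ∧ ¬ ConstMod (residueClass A i) (p ^ 2) := by
      push Not at hall
      exact hall
    obtain ⟨p, ⟨hp, hp2, hpc⟩, hmin⟩ : ∃ p : ℕ, (p.Prime ∧ p ≠ 2 ∧
        ¬ ConstMod (residueClass A i) (p ^ 2)) ∧ ∀ q < p, q.Prime → q ≠ 2 →
        ConstMod (residueClass A i) (q ^ 2) :=
      ⟨Nat.find hex, Nat.find_spec hex, fun q hq hq1 hq2 => by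
        have := Nat.find_min hex hq
        tauto⟩
    have hp3 : p ≠ 3 := by rintro rfl; exact hpc hi
    have hpair := relDensity_le_of_not_constMod_sq hA hji hp hp2 hpc
    by_cases hp5 : p = 5
    · subst hp5
      have h1 := relDensity_le_of_constMod_nine_of_not hA hij hi hj
      norm_num at hpair z1 z2 ⊢
      linarith
    have hp6 : 6 < p := by
      have := hp.two_le
      rcases (by omega : p = 4 ∨ p = 6 ∨ 6 < p) with h | h | h
      · exact absurd hp (by rw [h]; norm_num)
      · exact absurd hp (by rw [h]; norm_num)
      · exact h
    have h225 : ConstMod (residueClass A i) (9 * 25) :=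
      hi.mul (hmin 5 (by omega) Nat.prime_five (by norm_num)) (by norm_num)
    by_cases hp7 : p = 7
    · subst hp7
      have h1 := relDensity_le_of_constMod h4 h225 (by norm_num) (by norm_num)
      norm_num at hpair h1 z1 z2 ⊢
      linarith
    have hp10 : 10 < p := by
      rcases (by omega : p = 8 ∨ p = 9 ∨ p = 10 ∨ 10 < p) with h | h | h | h
      · exact absurd hp (by rw [h]; norm_num)
      · exact absurd hp (by rw [h]; norm_num)
      · exact absurd hp (by rw [h]; norm_num)
      · exact h
    obtain ⟨q, hq, hq1, hq2⟩ := Nat.exists_prime_lt_and_le_two_mul ((p - 1) / 2) (by omega)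
    have hqc := hmin q (by omega) hq (by omega)
    have hco : (9 * 25).Coprime (q ^ 2) := by
      rw [show 9 * 25 = (3 * 5) ^ 2 by norm_num]
      refine Nat.Coprime.pow 2 2 (Nat.Coprime.mul_left ?_ ?_)
      · exact (Nat.coprime_primes Nat.prime_three hq).2 (by omega)
      · exact (Nat.coprime_primes Nat.prime_five hq).2 (by omega)
    have h1 := relDensity_le_of_constMod h4 (h225.mul hqc hco)
      ((show Nat.Coprime 4 (9 * 25) by norm_num).mul_right
        ((coprime_four_of_prime hq (by omega)).pow_right 2))
      (by have := hq.pos; positivity)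
    push_cast at h1
    have hqr : (p : ℝ) ≤ 2 * q := by exact_mod_cast (by omega : p ≤ 2 * q)
    have hpr : (10 : ℝ) < p := by exact_mod_cast hp10
    have hp0 : (0 : ℝ) < (p : ℝ) ^ 2 - 1 := by nlinarith
    have h2 : 1 / (9 * 25 * (q : ℝ) ^ 2) ≤ 4 / 225 * (1 / ((p : ℝ) ^ 2 - 1)) := by
      rw [div_mul_div_comm, div_le_div_iff₀ (by nlinarith) (by positivity)]
      nlinarith
    have h3 : ((p : ℝ) ^ 2 - 2) / ((p : ℝ) ^ 2 - 1) = 1 - 1 / ((p : ℝ) ^ 2 - 1) := by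
      field_simp; ring
    rw [h3] at hpair
    have h4 : 0 < 1 / ((p : ℝ) ^ 2 - 1) := by positivity
    nlinarith

lemma relDensity_le_of_class_nine (hA : AvoidsSquarefree (A + A)) {i j : Fin 4}
    (hij : i + j ≠ 0) (hi : ConstMod (residueClass A i) 9) {a b : ℕ} (ha : a ∈ residueClass A i)
    (hb : b ∈ residueClass A j) (hab : ¬ 9 ∣ a + b) :
    relDensity (residueClass A i) ≤ (1 - 9 / 8 * (8 / Real.pi ^ 2)) / 9 := by
  have h := relDensity_le_of_class hA hij Nat.prime_three (by norm_num) hi ha hb hab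
  generalize 8 / Real.pi ^ 2 = z at h ⊢
  norm_num at h ⊢
  linarith

lemma zero_add_ne_and_two_add_ne : ∀ o : Fin 4, o + o ≠ 0 → 0 + o ≠ 0 ∧ 2 + o ≠ 0 := by decide

lemma sum_relDensity_le_of_forall_constMod (hA : AvoidsSquarefree (A + A))
    (hc : ∀ i, ConstMod (residueClass A i) 9) {o : Fin 4} (ho : o + o ≠ 0)
    (hone : (residueClass A o).Nonempty) {k : Fin 4} {x : ℕ} (hx : x ∈ residueClass A k)
    (hx9 : ¬ 9 ∣ x) :
    relDensity (residueClass A 0) + relDensity (residueClass A 1)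
      + relDensity (residueClass A 2) + relDensity (residueClass A 3) ≤ 1 - 8 / Real.pi ^ 2 := by
  obtain ⟨z1, z2⟩ := eight_div_pi_sq_bounds
  set τ := (1 - 9 / 8 * (8 / Real.pi ^ 2)) / 9 with hτ
  let Z : Fin 4 → Prop := fun i => ∀ a ∈ residueClass A i, 9 ∣ a
  have hτ0 : 0 < τ := by rw [hτ]; linarith
  have hdvd : ∀ i j, i + j ≠ 0 → τ < relDensity (residueClass A i) →
      ∀ a ∈ residueClass A i, ∀ b ∈ residueClass A j, 9 ∣ a + b := by
    intro i j hij hbig a ha b hb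
    by_contra h
    exact absurd (relDensity_le_of_class_nine hA hij (hc i) ha hb h) (not_le.2 hbig)
  have hne : ∀ i, τ < relDensity (residueClass A i) → (residueClass A i).Nonempty := by
    intro i hi
    by_contra h
    rw [Set.not_nonempty_iff_eq_empty] at h
    rw [h, relDensity_empty] at hi
    linarith
  have hself : ∀ i, i + i ≠ 0 → τ < relDensity (residueClass A i) → Z i := by
    intro i hi hbig a ha
    have := hdvd i i hi hbig a ha a ha
    omega
  have hnbr : ∀ i j, i + j ≠ 0 → τ < relDensity (residueClass A i) → Z i → Z j := by
    intro i j hij hbig hZ b hb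
    obtain ⟨a, ha⟩ := hne i hbig
    have h1 := hdvd i j hij hbig a ha b hb
    have h2 := hZ a ha
    omega
  have heven : τ < relDensity (residueClass A 0) → τ < relDensity (residueClass A 2) → Z 0 := by
    intro h0 h2 a ha
    obtain ⟨b, hb⟩ := hne 2 h2
    obtain ⟨c, hcc⟩ := hone
    have e1 := hdvd 0 2 (by decide) h0 a ha b hb
    have e2 := hdvd 0 o (zero_add_ne_and_two_add_ne o ho).1 h0 a ha c hcc
    have e3 := hdvd 2 o (zero_add_ne_and_two_add_ne o ho).2 h2 b hb c hcc
    omega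
  have hnot : ¬ (Z 0 ∧ Z 1 ∧ Z 2 ∧ Z 3) := by
    rintro ⟨h0, h1, h2, h3⟩
    fin_cases k
    · exact hx9 (h0 x hx)
    · exact hx9 (h1 x hx)
    · exact hx9 (h2 x hx)
    · exact hx9 (h3 x hx)
  have b0 := relDensity_le_of_constMod_nine (hc 0)
  have b1 := relDensity_le_of_constMod_nine (hc 1)
  have b2 := relDensity_le_of_constMod_nine (hc 2)
  have b3 := relDensity_le_of_constMod_nine (hc 3)
  have f0 : τ < relDensity (residueClass A 0) → Z 0 → False := fun b z =>
    hnot ⟨z, hnbr 0 1 (by decide) b z, hnbr 0 2 (by decide) b z, hnbr 0 3 (by decide) b z⟩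
  have f2 : τ < relDensity (residueClass A 2) → Z 2 → False := fun b z =>
    hnot ⟨hnbr 2 0 (by decide) b z, hnbr 2 1 (by decide) b z, z, hnbr 2 3 (by decide) b z⟩
  have s1 := hself 1 (by decide)
  have s3 := hself 3 (by decide)
  have n10 := fun b => hnbr 1 0 (by decide) b (s1 b)
  have n12 := fun b => hnbr 1 2 (by decide) b (s1 b)
  have n30 := fun b => hnbr 3 0 (by decide) b (s3 b)
  have n32 := fun b => hnbr 3 2 (by decide) b (s3 b)
  rcases le_or_gt (relDensity (residueClass A 0)) τ with c0 | c0 <;>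
  rcases le_or_gt (relDensity (residueClass A 1)) τ with c1 | c1 <;>
  rcases le_or_gt (relDensity (residueClass A 2)) τ with c2 | c2 <;>
  rcases le_or_gt (relDensity (residueClass A 3)) τ with c3 | c3 <;>
  first
  | exact (f0 c0 (n10 c1)).elim
  | exact (f0 c0 (n30 c3)).elim
  | exact (f0 c0 (heven c0 c2)).elim
  | exact (f2 c2 (n12 c1)).elim
  | exact (f2 c2 (n32 c3)).elim
  | exact (hnot ⟨n10 c1, s1 c1, n12 c1, s3 c3⟩).elim
  | linarith


lemma sum_relDensity_le (hA : AvoidsSquarefree (A + A)) {o : Fin 4} (ho : o + o ≠ 0)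
    (hone : (residueClass A o).Nonempty) {k : Fin 4} {x : ℕ} (hx : x ∈ residueClass A k)
    (hx9 : ¬ 9 ∣ x) :
    relDensity (residueClass A 0) + relDensity (residueClass A 1)
      + relDensity (residueClass A 2) + relDensity (residueClass A 3) ≤ 1 - 8 / Real.pi ^ 2 := by
  obtain ⟨z1, z2⟩ := eight_div_pi_sq_bounds
  by_cases hall : ∀ i, ConstMod (residueClass A i) 9
  · exact sum_relDensity_le_of_forall_constMod hA hall ho hone hx hx9
  have hone' : relDensity (residueClass A 0) ≤ 1 - 8 / Real.pi ^ 2 ∧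
      relDensity (residueClass A 2) ≤ 1 - 8 / Real.pi ^ 2 :=
    ⟨relDensity_le_of_mem hA (zero_add_ne_and_two_add_ne o ho).1 hone,
      relDensity_le_of_mem hA (zero_add_ne_and_two_add_ne o ho).2 hone⟩
  have hthree : ∀ j, ¬ ConstMod (residueClass A j) 9 →
      relDensity (residueClass A j) ≤ 1 - 8 / Real.pi ^ 2 → ∀ i, i + j ≠ 0 →
      ConstMod (residueClass A i) 9 →
      relDensity (residueClass A j) + 3 * relDensity (residueClass A i) ≤ 1 - 8 / Real.pi ^ 2 := by
    intro j hj hj' i hij hi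
    rcases (residueClass A i).eq_empty_or_nonempty with h | h
    · rw [h, relDensity_empty]; linarith
    · exact relDensity_add_three_mul_le hA hij h hi hj
  have hbig : ∀ j, ¬ ConstMod (residueClass A j) 9 → relDensity (residueClass A j) ≤ 0.0445 ∨
      ∀ i, i + j ≠ 0 → relDensity (residueClass A i) ≤ 0.0445 := by
    intro j hj
    by_cases h25 : ConstMod (residueClass A j) 25
    · left
      have := relDensity_le_of_constMod_twentyfive h25
      linarith
    · refine (relDensity_le_or_forall_le hA hj h25).imp_left fun h => ?_
      linarith
  have hodd : ∀ j, j + j ≠ 0 → ¬ ConstMod (residueClass A j) 9 →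
      relDensity (residueClass A j) ≤ 0.0445 :=
    fun j hj h9 => (hbig j h9).elim id fun h => h j hj
  have hsmall : ∀ i j, i + j ≠ 0 → 0.0445 < relDensity (residueClass A i) →
      ¬ ConstMod (residueClass A j) 9 → relDensity (residueClass A j) ≤ 0.0205 := by
    intro i j hij hi hj
    by_cases h25 : ConstMod (residueClass A j) 25
    · refine relDensity_le_of_constMod_twentyfive_of_not hA (by rwa [add_comm]) h25 fun h => ?_
      have := relDensity_le_of_constMod_twentyfive h
      linarith
    · refine (relDensity_le_or_forall_le hA hj h25).elim id fun h => ?_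
      linarith [h i hij]
  have t9 := fun i j hij hi hj => relDensity_le_of_constMod_nine_of_not hA (i := i) (j := j) hij hi hj
  have t := fun i j hij hj => relDensity_le_of_not_constMod_nine hA (i := i) (j := j) hij hj
  have c9 := fun i => relDensity_le_of_constMod_nine (A := A) (i := i)
  obtain ⟨e0, e2⟩ := hone'
  by_cases c0 : ConstMod (residueClass A 0) 9 <;> by_cases c1 : ConstMod (residueClass A 1) 9 <;>
  by_cases c2 : ConstMod (residueClass A 2) 9 <;> by_cases c3 : ConstMod (residueClass A 3) 9
  · exact absurd (fun i => by fin_cases i <;> assumption) hall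
  · linarith [t9 0 3 (by decide) c0 c3, t9 2 3 (by decide) c2 c3, c9 1 c1, hodd 3 (by decide) c3]
  · linarith [hthree 2 c2 e2 0 (by decide) c0, hthree 2 c2 e2 1 (by decide) c1,
      hthree 2 c2 e2 3 (by decide) c3]
  · linarith [t9 0 2 (by decide) c0 c2, t9 1 2 (by decide) c1 c2, t 2 3 (by decide) c3,
      hodd 3 (by decide) c3]
  · linarith [t9 0 1 (by decide) c0 c1, t9 2 1 (by decide) c2 c1, c9 3 c3, hodd 1 (by decide) c1]
  · linarith [t9 0 1 (by decide) c0 c1, t9 2 1 (by decide) c2 c1, hodd 1 (by decide) c1,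
      hodd 3 (by decide) c3]
  · linarith [t9 0 2 (by decide) c0 c2, t9 3 2 (by decide) c3 c2, t 2 1 (by decide) c1,
      hodd 1 (by decide) c1]
  · linarith [t9 0 2 (by decide) c0 c2, t 2 1 (by decide) c1,
      hodd 1 (by decide) c1, hodd 3 (by decide) c3]
  · linarith [hthree 0 c0 e0 1 (by decide) c1, hthree 0 c0 e0 2 (by decide) c2,
      hthree 0 c0 e0 3 (by decide) c3]
  · linarith [t9 2 0 (by decide) c2 c0, t9 1 0 (by decide) c1 c0, t 0 3 (by decide) c3,
      hodd 3 (by decide) c3]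
  · have h := (hbig 0 c0).imp_right fun h => h 2 (by decide)
    rcases h with h | h <;>
    linarith [t9 1 0 (by decide) c1 c0, t9 3 0 (by decide) c3 c0, t 0 2 (by decide) c2,
      t 2 0 (by decide) c0]
  · have h := (hbig 0 c0).imp_right fun h => h 2 (by decide)
    rcases h with h | h <;>
    linarith [t9 1 0 (by decide) c1 c0, hodd 3 (by decide) c3, t 0 2 (by decide) c2,
      t 2 0 (by decide) c0]
  · linarith [t9 2 0 (by decide) c2 c0, t9 3 0 (by decide) c3 c0, t 0 1 (by decide) c1,
      hodd 1 (by decide) c1]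
  · linarith [t9 2 0 (by decide) c2 c0, t 0 1 (by decide) c1,
      hodd 1 (by decide) c1, hodd 3 (by decide) c3]
  · have h := (hbig 0 c0).imp_right fun h => h 2 (by decide)
    rcases h with h | h <;>
    linarith [t9 3 0 (by decide) c3 c0, hodd 1 (by decide) c1, t 0 2 (by decide) c2,
      t 2 0 (by decide) c0]
  · rcases le_or_gt (relDensity (residueClass A 0)) 0.0445 with h0 | h0
    · rcases le_or_gt (relDensity (residueClass A 2)) 0.0445 with h2 | h2
      · linarith [hodd 1 (by decide) c1, hodd 3 (by decide) c3]
      · linarith [hsmall 2 0 (by decide) h2 c0, hsmall 2 1 (by decide) h2 c1,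
          hsmall 2 3 (by decide) h2 c3, t 2 0 (by decide) c0]
    · linarith [hsmall 0 2 (by decide) h0 c2, hsmall 0 1 (by decide) h0 c1,
          hsmall 0 3 (by decide) h0 c3, t 0 2 (by decide) c2]

lemma relDensity_zero_add_two_le (hA : AvoidsSquarefree (A + A))
    (h0 : (residueClass A 0).Nonempty) (h2 : (residueClass A 2).Nonempty) :
    relDensity (residueClass A 0) + relDensity (residueClass A 2) ≤ 2 / 9 := by
  obtain ⟨z1, z2⟩ := eight_div_pi_sq_bounds
  have e0 := relDensity_le_of_mem hA (i := 0) (j := 2) (by decide) h2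
  have e2 := relDensity_le_of_mem hA (i := 2) (j := 0) (by decide) h0
  by_cases c0 : ConstMod (residueClass A 0) 9 <;> by_cases c2 : ConstMod (residueClass A 2) 9
  · linarith [relDensity_le_of_constMod_nine c0, relDensity_le_of_constMod_nine c2]
  · linarith [relDensity_le_of_constMod_nine_of_not hA (by decide) c0 c2]
  · linarith [relDensity_le_of_constMod_nine_of_not hA (by decide) c2 c0]
  · linarith [relDensity_le_of_not_constMod_nine hA (i := 0) (by decide) c2,
      relDensity_le_of_not_constMod_nine hA (i := 2) (by decide) c0]

lemma exists_mem_residueClass {n : ℕ} (hn : n ∈ A) : n ∈ residueClass A (Fin.ofNat 4 n) :=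
  ⟨hn, by simp [Fin.ofNat]⟩

/-- A set of large upper density whose sumset contains no squarefree integer, and which contains an
odd element, consists of multiples of nine. -/
theorem nine_dvd_of_odd_mem (hA : AvoidsSquarefree (A + A))
    (hd : 1 / 4 - 2 / Real.pi ^ 2 < upperDensity A) {o : ℕ} (ho : o ∈ A) (hodd : o % 2 = 1) :
    ∀ a ∈ A, 9 ∣ a := by
  by_contra! h
  obtain ⟨x, hx, hx9⟩ := h
  have h1 := sum_relDensity_le hA (o := Fin.ofNat 4 o) (by
    intro h
    have := congrArg Fin.val h
    rw [Fin.val_add, Fin.val_zero] at this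
    simp only [Fin.ofNat] at this
    omega) ⟨o, exists_mem_residueClass ho⟩ (exists_mem_residueClass hx) hx9
  have h2 := upperDensity_le_sum_relDensity A
  have h3 : 8 / Real.pi ^ 2 = 4 * (2 / Real.pi ^ 2) := by ring
  linarith

theorem mod_four_eq_of_even (hA : AvoidsSquarefree (A + A)) (hd : 1 / 18 < upperDensity A)
    (he : ∀ a ∈ A, a % 2 = 0) : (∀ a ∈ A, a % 4 = 0) ∨ ∀ a ∈ A, a % 4 = 2 := by
  by_contra! h
  obtain ⟨⟨a, ha, ha4⟩, b, hb, hb4⟩ := h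
  have h1 := relDensity_zero_add_two_le hA ⟨b, hb, show b % 4 = 0 by have := he b hb; omega⟩
    ⟨a, ha, show a % 4 = 2 by have := he a ha; omega⟩
  have h2 := upperDensity_le_sum_relDensity A
  have e : ∀ i : Fin 4, i + i ≠ 0 → residueClass A i = ∅ := fun i hi => by
    rw [Set.eq_empty_iff_forall_notMem]
    rintro n ⟨hn, hni⟩
    have := he n hn
    fin_cases i <;> simp at hi hni <;> omega
  rw [e 1 (by decide), e 3 (by decide), relDensity_empty] at h2
  linarith

lemma subsetSums_subset_of_dvd {B : Set ℕ} {m : ℕ} (h : ∀ b ∈ B, m ∣ b) :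
    subsetSums B ⊆ {n | n ≡ 0 [MOD m]} := by
  rintro n ⟨s, hs, rfl⟩
  exact Nat.modEq_zero_iff_dvd.2 (Finset.dvd_sum fun a ha => h a (hs ha))

lemma upperDensity_subsetSums_le {B : Set ℕ} {m : ℕ} (hm : 0 < m) (h : ∀ b ∈ B, m ∣ b) :
    upperDensity (subsetSums B) ≤ 1 / m := by
  rw [← (hasDensity_modEq hm 0).upperDensity_eq]
  exact upperDensity_mono (subsetSums_subset_of_dvd h)

theorem upperDensity_subsetSums_add_le (hA : AvoidsSquarefree (A + A))
    (hd : 1 / 18 < upperDensity A) : upperDensity (subsetSums (A + A)) ≤ 1 / 4 := by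
  obtain ⟨z1, z2⟩ := eight_div_pi_sq_bounds
  have h3 : 8 / Real.pi ^ 2 = 4 * (2 / Real.pi ^ 2) := by ring
  by_cases he : ∀ a ∈ A, a % 2 = 0
  · have h4 : ∀ b ∈ A + A, 4 ∣ b := by
      rintro _ ⟨a, ha, b, hb, rfl⟩
      rcases mod_four_eq_of_even hA hd he with h | h <;>
      · have h1 := h a ha
        have h2 := h b hb
        simp only
        omega
    simpa using upperDensity_subsetSums_le (by norm_num) h4
  · push Not at he
    obtain ⟨o, ho, ho2⟩ := he
    have h9 := nine_dvd_of_odd_mem hA (by linarith) ho (by omega)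
    have h := upperDensity_subsetSums_le (B := A + A) (m := 9) (by norm_num) (by
      rintro _ ⟨a, ha, b, hb, rfl⟩
      exact dvd_add (h9 a ha) (h9 b hb))
    norm_num at h ⊢
    linarith

theorem upperDensity_subsetSums_le_half (hA : AvoidsSquarefree (A + A))
    (hd : 1 / 4 - 2 / Real.pi ^ 2 < upperDensity A) : upperDensity (subsetSums A) ≤ 1 / 2 := by
  by_cases he : ∀ a ∈ A, a % 2 = 0
  · simpa using upperDensity_subsetSums_le (m := 2) (by norm_num)
      fun b hb => Nat.dvd_of_mod_eq_zero (he b hb)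
  · push Not at he
    obtain ⟨o, ho, ho2⟩ := he
    have h := upperDensity_subsetSums_le (m := 9) (by norm_num)
      (nine_dvd_of_odd_mem hA hd ho (by omega))
    norm_num at h ⊢
    linarith

end UpperBounds

section Examples

open Filter

lemma not_squarefree_of_sq_dvd {p n : ℕ} (hp : p ≠ 1) (h : p ^ 2 ∣ n) : ¬ Squarefree n :=
  fun hs => hp (Nat.isUnit_iff.1 (hs p (by rwa [← pow_two])))

theorem exists_hasDensity_one_div_eighteen :
    ∃ A : Set ℕ, 0 ∉ A ∧ HasDensity A (1 / 18) ∧ AvoidsSquarefree (A + A) ∧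
      (∃ n ∈ A + A + A, Squarefree n) ∧
      (∃ N : ℕ, ∀ n : ℕ, N ≤ n → Even n → IsSumOfAtMost A 6 n) := by
  refine ⟨{n | n % 36 = 26 ∨ n % 36 = 28}, by simp, ?_, ?_, ?_, 200, ?_⟩
  · have h := hasDensity_of_periodic (P := fun n => n % 36 = 26 ∨ n % 36 = 28) (m := 36)
      (by norm_num) (fun n => by simp)
    have hc : Nat.count (fun n => n % 36 = 26 ∨ n % 36 = 28) 36 = 2 := by decide
    rw [hc] at h
    convert h using 1
    norm_num
  · rintro _ ⟨a, ha, b, hb, rfl⟩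
    have h : 2 ^ 2 ∣ a + b ∨ 3 ^ 2 ∣ a + b := by
      simp only [Set.mem_ofPred_eq] at ha hb
      omega
    exact h.elim (not_squarefree_of_sq_dvd (by norm_num)) (not_squarefree_of_sq_dvd (by norm_num))
  · refine ⟨82, ⟨56, ⟨28, by simp, 28, by simp, rfl⟩, 26, by simp, rfl⟩, ?_⟩
    rw [show 82 = 2 * 41 by norm_num, Nat.squarefree_mul (by norm_num)]
    exact ⟨Nat.prime_two.squarefree, (by norm_num : Nat.Prime 41).squarefree⟩
  · intro n hn he
    have hres : ∀ r < 36, r % 2 = 0 → ∃ i ≤ 5, ∃ j ≤ 5, i + j ≤ 5 ∧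
        ((28 + 28 * i + 26 * j) % 36 = r ∨ (26 + 28 * i + 26 * j) % 36 = r) := by decide
    obtain ⟨i, hi, j, hj, hij, h⟩ := hres (n % 36) (Nat.mod_lt _ (by norm_num))
      (by have := Nat.even_iff.1 he; omega)
    refine ⟨(n - 28 * i - 26 * j) ::ₘ (Multiset.replicate i 28 + Multiset.replicate j 26), ?_, ?_, ?_⟩
    · simp; omega
    · intro a ha
      rw [Multiset.mem_cons, Multiset.mem_add, Multiset.mem_replicate, Multiset.mem_replicate] at ha
      simp only [Set.mem_ofPred_eq]
      omega
    · simp; omega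

open Classical in
lemma hasDensity_exists_sq_dvd {M s : ℕ} (hM : 0 < M) {S : Finset ℕ}
    (hS : ∀ p ∈ S, p.Prime) (hMS : ∀ p ∈ S, M.Coprime p) :
    HasDensity {n | n ≡ s [MOD M] ∧ ∃ p ∈ S, p ^ 2 ∣ n}
      (1 / M * (1 - ∏ p ∈ S, (1 - 1 / (p : ℝ) ^ 2))) := by
  have h := (hasDensity_modEq hM s).sdiff (hasDensity_not_dvd hM s 0 hS hMS) fun n hn => hn.1
  convert h using 1
  · ext n
    simp only [add_zero, Set.mem_sdiff, Set.mem_ofPred_eq, not_and, not_forall, not_not]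
    constructor
    · rintro ⟨h1, p, hp, hd⟩
      exact ⟨h1, fun _ => ⟨p, hp, hd⟩⟩
    · rintro ⟨h1, h2⟩
      obtain ⟨p, hp, hd⟩ := h2 h1
      exact ⟨h1, p, hp, hd⟩
  · ring

/-- The numbers `2` modulo `4` divisible by the square of an element of `S`, and three multiples of
`K`. -/
def thinBasis (S : Finset ℕ) (K : ℕ) : Set ℕ :=
  {n | n % 4 = 2 ∧ ∃ p ∈ S, p ^ 2 ∣ n} ∪ {K, 3 * K, 4 * K}

section ThinBasis

variable {S : Finset ℕ} {K : ℕ}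

lemma exists_sq_dvd_of_mem_add (h3 : 3 ∈ S) (hK : ∀ p ∈ S, p ^ 2 ∣ K) {n : ℕ}
    (hn : n ∈ thinBasis S K + thinBasis S K) : 4 ∣ n ∨ ∃ p ∈ S, p ^ 2 ∣ n := by
  have hmul : ∀ x ∈ ({K, 3 * K, 4 * K} : Set ℕ), ∀ p ∈ S, p ^ 2 ∣ x := by
    rintro x (rfl | rfl | rfl) p hp
    · exact hK p hp
    · exact (hK p hp).mul_left 3
    · exact (hK p hp).mul_left 4
  obtain ⟨a, ha | ha, b, hb | hb, rfl⟩ := hn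
  · left
    have h1 := ha.1
    have h2 := hb.1
    simp only
    omega
  · obtain ⟨p, hp, hd⟩ := ha.2
    exact Or.inr ⟨p, hp, dvd_add hd (hmul b hb p hp)⟩
  · obtain ⟨p, hp, hd⟩ := hb.2
    exact Or.inr ⟨p, hp, dvd_add (hmul a ha p hp) hd⟩
  · exact Or.inr ⟨3, h3, dvd_add (hmul a ha 3 h3) (hmul b hb 3 h3)⟩

lemma mem_add_of_four_dvd (h3 : 3 ∈ S) (h5 : 5 ∈ S) {n : ℕ} (hn : 4 ∣ n) (h : 900 ≤ n) :
    n ∈ thinBasis S K + thinBasis S K := by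
  refine ⟨18 + 36 * ((16 * n + 12) % 25), Or.inl ⟨by omega, 3, h3, by omega⟩,
    n - (18 + 36 * ((16 * n + 12) % 25)), Or.inl ⟨by omega, 5, h5, by omega⟩, ?_⟩
  simp only
  omega

lemma mem_add_of_sq_dvd (hK : ∀ p ∈ S, p ^ 2 ∣ K) (hodd : K % 2 = 1) {n p : ℕ} (hn : ¬ 4 ∣ n)
    (hp : p ∈ S) (hd : p ^ 2 ∣ n) (h : 4 * K ≤ n) : n ∈ thinBasis S K + thinBasis S K := by
  have hb : ∀ c ≤ 4, (n - c * K) % 4 = 2 → n - c * K ∈ thinBasis S K := fun c _ h2 =>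
    Or.inl ⟨h2, p, hp, Nat.dvd_sub hd ((hK p hp).mul_left c)⟩
  have h1 := hb 1 (by norm_num)
  have h3 := hb 3 (by norm_num)
  have h4 := hb 4 (by norm_num)
  have hc : (n - 1 * K) % 4 = 2 ∨ (n - 3 * K) % 4 = 2 ∨ (n - 4 * K) % 4 = 2 := by omega
  rcases hc with hc | hc | hc
  · exact ⟨_, h1 hc, K, Or.inr (by simp), by simp only; omega⟩
  · exact ⟨_, h3 hc, 3 * K, Or.inr (by simp), by simp only; omega⟩
  · exact ⟨_, h4 hc, 4 * K, Or.inr (by simp), by simp only; omega⟩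

lemma mem_add_add (h3 : 3 ∈ S) (h5 : 5 ∈ S) (hodd : K % 2 = 1) {n : ℕ} (h : 918 + 4 * K ≤ n) :
    n ∈ thinBasis S K + thinBasis S K + thinBasis S K := by
  have hc : n % 4 = 2 ∨ (n - K) % 4 = 0 ∨ (n - 3 * K) % 4 = 0 ∨ (n - 4 * K) % 4 = 0 := by omega
  rcases hc with hc | hc | hc | hc
  · exact ⟨n - 18, mem_add_of_four_dvd h3 h5 (by omega) (by omega), 18,
      Or.inl ⟨by norm_num, 3, h3, by norm_num⟩, by simp only; omega⟩
  · exact ⟨n - K, mem_add_of_four_dvd h3 h5 (by omega) (by omega), K, Or.inr (by simp),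
      by simp only; omega⟩
  · exact ⟨n - 3 * K, mem_add_of_four_dvd h3 h5 (by omega) (by omega), 3 * K, Or.inr (by simp),
      by simp only; omega⟩
  · exact ⟨n - 4 * K, mem_add_of_four_dvd h3 h5 (by omega) (by omega), 4 * K, Or.inr (by simp),
      by simp only; omega⟩

end ThinBasis

lemma lt_prod_primesBelow (N : ℕ) :
    6 / Real.pi ^ 2 < ∏ p ∈ N.primesBelow, (1 - 1 / (p : ℝ) ^ 2) := by
  have hpos : ∀ M : ℕ, 0 < ∏ p ∈ M.primesBelow, (1 - 1 / (p : ℝ) ^ 2) := fun M =>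
    Finset.prod_pos fun p hp => one_sub_inv_sq_pos (Nat.mem_primesBelow.1 hp).2
  have hanti : ∀ M M' : ℕ, M ≤ M' → ∏ p ∈ M'.primesBelow, (1 - 1 / (p : ℝ) ^ 2) ≤
      ∏ p ∈ M.primesBelow, (1 - 1 / (p : ℝ) ^ 2) := by
    intro M M' h
    refine Finset.prod_le_prod_of_subset_of_le_one (fun p hp => ?_) (fun p hp => ?_) fun p hp _ => ?_
    · rw [Nat.mem_primesBelow] at hp ⊢
      exact ⟨hp.1.trans_le h, hp.2⟩
    · exact (one_sub_inv_sq_pos (Nat.mem_primesBelow.1 hp).2).le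
    · have : (0 : ℝ) ≤ 1 / (p : ℝ) ^ 2 := by positivity
      linarith
  obtain ⟨q, hqN, hq⟩ := Nat.exists_infinite_primes N
  have h1 : 6 / Real.pi ^ 2 ≤ ∏ p ∈ (q + 1).primesBelow, (1 - 1 / (p : ℝ) ^ 2) :=
    le_of_tendsto tendsto_prod_primesBelow (by
      filter_upwards [eventually_ge_atTop (q + 1)] with M hM
      exact hanti _ _ hM)
  refine h1.trans_lt (lt_of_lt_of_le ?_ (hanti N q hqN))
  rw [Nat.primesBelow_succ, if_pos hq, Finset.prod_insert (by simp [Nat.mem_primesBelow])]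
  have h2 : (0 : ℝ) < 1 / (q : ℝ) ^ 2 := by
    have : (0 : ℝ) < q := by exact_mod_cast hq.pos
    positivity
  nlinarith [hpos q]

theorem exists_thin_basis {ε : ℝ} (hε : 0 < ε) :
    ∃ A : Set ℕ, 0 ∉ A ∧ AvoidsSquarefree (A + A) ∧
      (∃ ε₁ : ℝ, 0 < ε₁ ∧ ε₁ < ε ∧ HasDensity A (1 / 4 - 2 / Real.pi ^ 2 - ε₁)) ∧
      (∃ ε₂ : ℝ, 0 < ε₂ ∧ ε₂ < ε ∧ HasDensity (A + A) (1 - 6 / Real.pi ^ 2 - ε₂)) ∧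
      (A + A + A)ᶜ.Finite := by
  obtain ⟨N, hN, hN6⟩ := ((tendsto_prod_primesBelow.eventually_lt_const
    (lt_add_of_pos_right _ hε)).and (eventually_ge_atTop 6)).exists
  have hlt := lt_prod_primesBelow N
  set S := N.primesBelow.erase 2 with hSdef
  have h2mem : 2 ∈ N.primesBelow := Nat.mem_primesBelow.2 ⟨by omega, Nat.prime_two⟩
  have hprod := Finset.mul_prod_erase N.primesBelow (fun p : ℕ => 1 - 1 / (p : ℝ) ^ 2) h2mem
  rw [← hSdef] at hprod
  set w := ∏ p ∈ S, (1 - 1 / (p : ℝ) ^ 2) with hw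
  set W := ∏ p ∈ N.primesBelow, (1 - 1 / (p : ℝ) ^ 2) with hW
  have hwW : w = 4 / 3 * W := by
    rw [← hprod]; push_cast; ring
  set δ := W - 6 / Real.pi ^ 2 with hδ
  have hS : ∀ p ∈ S, p.Prime := fun p hp => (Nat.mem_primesBelow.1 (Finset.mem_erase.1 hp).2).2
  have hS2 : ∀ p ∈ S, p ≠ 2 := fun p hp => (Finset.mem_erase.1 hp).1
  have h3 : 3 ∈ S :=
    Finset.mem_erase.2 ⟨by norm_num, Nat.mem_primesBelow.2 ⟨by omega, Nat.prime_three⟩⟩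
  have h5 : 5 ∈ S :=
    Finset.mem_erase.2 ⟨by norm_num, Nat.mem_primesBelow.2 ⟨by omega, Nat.prime_five⟩⟩
  set K := ∏ p ∈ S, p ^ 2 with hKdef
  have hK : ∀ p ∈ S, p ^ 2 ∣ K := fun p hp => Finset.dvd_prod_of_mem (fun p => p ^ 2) hp
  have hodd : K % 2 = 1 := by
    rw [← Nat.odd_iff]
    refine Finset.prod_induction (fun p => p ^ 2) Odd (fun _ _ => Odd.mul) odd_one fun p hp => ?_
    exact ((hS p hp).odd_of_ne_two (hS2 p hp)).pow
  have hcop : ∀ p ∈ S, Nat.Coprime 4 p := fun p hp => by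
    rw [show (4 : ℕ) = 2 ^ 2 by norm_num]
    exact Nat.Coprime.pow_left 2 ((Nat.coprime_primes Nat.prime_two (hS p hp)).2 (hS2 p hp).symm)
  refine ⟨thinBasis S K, ?_, ?_, ⟨δ / 3, ?_, ?_, ?_⟩, ⟨δ, ?_, ?_, ?_⟩, ?_⟩
  · rintro (h | h)
    · simpa using h.1
    · simp only [Set.mem_insert_iff, Set.mem_singleton_iff] at h
      omega
  · intro n hn
    rcases exists_sq_dvd_of_mem_add h3 hK hn with h | ⟨p, hp, hd⟩
    · exact not_squarefree_of_sq_dvd (p := 2) (by norm_num) h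
    · exact not_squarefree_of_sq_dvd (hS p hp).ne_one hd
  · linarith
  · linarith
  · have h := hasDensity_exists_sq_dvd (M := 4) (s := 2) (by norm_num) hS hcop
    rw [← hw, hwW] at h
    have h' := h.of_eventually_iff (B := thinBasis S K) (4 * K + 1) fun n hn => by
      unfold thinBasis
      simp only [Set.mem_union, Set.mem_insert_iff, Set.mem_singleton_iff, Set.mem_ofPred_eq]
      constructor
      · exact fun h => Or.inl h
      · rintro (h | h)
        · exact h
        · omega
    convert h' using 1
    rw [hδ]; push_cast; ring
  · linarith
  · linarith
  · have h := hasDensity_exists_sq_dvd (M := 1) (s := 0) (S := N.primesBelow) (by norm_num)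
      (fun p hp => (Nat.mem_primesBelow.1 hp).2) (fun p _ => Nat.coprime_one_left p)
    rw [← hW] at h
    have h' := h.of_eventually_iff (B := thinBasis S K + thinBasis S K) (900 + 4 * K) fun n hn => by
      constructor
      · rintro ⟨-, p, hp, hd⟩
        by_cases h4 : 4 ∣ n
        · exact mem_add_of_four_dvd h3 h5 h4 (by omega)
        · refine mem_add_of_sq_dvd hK hodd h4 (Finset.mem_erase.2 ⟨?_, hp⟩) hd (by omega)
          rintro rfl
          exact h4 hd
      · intro hn
        refine ⟨Nat.modEq_one, ?_⟩
        rcases exists_sq_dvd_of_mem_add h3 hK hn with h | ⟨p, hp, hd⟩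
        · exact ⟨2, h2mem, h⟩
        · exact ⟨p, (Finset.mem_erase.1 hp).2, hd⟩
    convert h' using 1
    rw [hδ]; push_cast; ring
  · refine (Set.finite_lt_nat (918 + 4 * K)).subset fun n hn => ?_
    by_contra h
    exact hn (mem_add_add h3 h5 hodd (not_lt.1 h))

end Examples

theorem mainTheorem2 :
    (∀ A : Set ℕ, AvoidsSquarefree (A + A) →
      (1 / 18 < upperDensity A → upperDensity (subsetSums (A + A)) ≤ 1 / 4) ∧
      (1 / 4 - 2 / Real.pi ^ 2 < upperDensity A → upperDensity (subsetSums A) ≤ 1 / 2)) ∧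
    (∃ A : Set ℕ, 0 ∉ A ∧ HasDensity A (1 / 18) ∧
      AvoidsSquarefree (A + A) ∧
      (∃ n ∈ A + A + A, Squarefree n) ∧
      (∃ N : ℕ, ∀ n : ℕ, N ≤ n → Even n → IsSumOfAtMost A 6 n)) ∧
    (∀ ε : ℝ, 0 < ε →
      ∃ A : Set ℕ, 0 ∉ A ∧ AvoidsSquarefree (A + A) ∧
        (∃ ε₁ : ℝ, 0 < ε₁ ∧ ε₁ < ε ∧ HasDensity A (1 / 4 - 2 / Real.pi ^ 2 - ε₁)) ∧
        (∃ ε₂ : ℝ, 0 < ε₂ ∧ ε₂ < ε ∧ HasDensity (A + A) (1 - 6 / Real.pi ^ 2 - ε₂)) ∧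
        (A + A + A)ᶜ.Finite) := by
  exact ⟨fun _ hA => ⟨upperDensity_subsetSums_add_le hA, upperDensity_subsetSums_le_half hA⟩,
    exists_hasDensity_one_div_eighteen, fun _ hε => exists_thin_basis hε⟩
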